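/- **Setting.** Let $\Sigma$ be the brick-wall drawing of the honeycomb lattice in the plane: its vertex set is $V=\mathbb Z^2\subset\mathbb R^2$, its edges are all horizontal unit segments between lattice points and the vertical unit segments whose lower end $(x,y)$ has $x+y$ odd, and its faces are the $2\times 1$ bricks with lower left corner $(a,b)$, $a+b$ odd. Each face $f$ has six vertices $\partial f=\{a,a+1,a+2\}\times\{b,b+1\}$, and is colored $\mathtt r,\mathtt g,\mathtt b$ according to $a \bmod 3$, so that adjacent faces have different colors. An edge connects the faces $f,g$ if it leaves $f$ at one of its ends and arrives in $g$ at the other. Let $\mathcal A$ be the quasi-local $C^*$-algebra with one qubit $M_2(\mathbb C)$ at each vertex, i.e. the norm completion of $\bigcup_{\Lambda}\bigotimes_{v\in\Lambda}M_2(\mathbb C)$ over finite $\Lambda\subset V$, and for $\Lambda\subset V$ let $\mathcal A(\Lambda)$ be the closed subalgebra generated by the observables at the vertices of $\Lambda$. For a face $f$ put $K_f=\prod_{v\in\partial f}\sigma^{\mathtt x}_v$ and $J_f=\prod_{v\in\partial f}\sigma^{\mathtt z}_v$. Let $\omega_0$ be a state on $\mathcal A$ with $\omega_0(K_f)=\omega_0(J_f)=1$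 for all faces $f$ (the ground state of the color code), and let $\pi_0$ be its GNS representation. For $c\in\{\mathtt r,\mathtt g,\mathtt b\}$, a half-infinite string of color $c$ starting at $f_0$ is a sequence $\gamma=(f_0,v_0,v_1,f_1,v_2,v_3,f_2,\dots)$ of $c$-colored faces $f_i$ and vertices such that $v_{2i}v_{2i+1}$ is an edge leaving $f_i$ at $v_{2i}$ and arriving in $f_{i+1}$ at $v_{2i+1}$, and such that each vertex occurs only finitely often. Let $\gamma_n$ be its part formed by the first $n$ faces and the vertices between them, and put $S^{c\mathtt x}_{\gamma_n}=\prod_{v_j\in\gamma_n}\sigma^{\mathtt x}_{v_j}$, $S^{c\mathtt z}_{\gamma_n}=\prod_{v_j\in\gamma_n}\sigma^{\mathtt z}_{v_j}$, $S^{c\mathtt y}_{\gamma_n}=S^{c\mathtt x}_{\gamma_n}S^{c\mathtt z}_{\gamma_n}$. For $k\in\{\mathtt x,\mathtt y,\mathtt z\}$ let $\rho^{ck}_\gamma(A)=\lim_n (S^{ck}_{\gamma_n})^*AS^{ck}_{\gamma_n}$ (norm limit), a unital $*$-endomorphism of $\mathcal A$. A cone is a set of vertices $\Lambda=\{v\in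 V: (v-p)\cdot a>\|v-p\|\cos\theta\}$ with $p\in\mathbb R^2$, $a$ a unit vector and $\theta\in(0,\pi)$; $\Lambda^c=V\setminus\Lambda$. The symbol $\simeq$ denotes unitary equivalence of representations. **Theorem.** The state $\omega_0$ exists and is unique. Each face is the starting face of a half-infinite string of its color, and for a half-infinite string $\gamma$ of color $c$ the state $\omega_f^{ck}=\omega_0\circ\rho^{ck}_\gamma$ depends only on $c,k$ and the starting face $f$ of $\gamma$. Let $\pi^{ck}_f$ be the GNS representation of $\omega_f^{ck}$. Then: 1. $\pi^{ck}_f$ satisfies the superselection criterion: $\pi_f^{ck}|_{\mathcal A(\Lambda^c)}\simeq\pi_0|_{\mathcal A(\Lambda^c)}$ for every cone $\Lambda$, all $c,k$ and all $c$-colored faces $f$. 2. $\pi_f^{ck}\simeq\pi_{f'}^{ck}$ for all $c$-colored faces $f,f'$. 3. $\pi_f^{ck}\simeq\pi_{f'}^{c'k'}$ if and only if $c=c'$ and $k=k'$. In particular the $\pi^{ck}_f$ fall into exactly nine unitary equivalence classes. -/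

import Mathlib

namespace ColorCode
open scoped ComplexOrder InnerProductSpace
open Filter Topology
noncomputable section

/-- The vertices of the brick-wall drawing of the honeycomb lattice: all integer points of the plane. -/
abbrev Vertex : Type := ℤ × ℤ
/-- Basis configurations of the qubits: all but finitely many qubits are in state `0`. -/
abbrev Config : Type := Vertex →₀ Fin 2
/-- The reference Hilbert space: the infinite tensor product of the qubit spaces `ℂ²` along the
vector `|0⟩ ⊗ |0⟩ ⊗ ⋯`, with orthonormal basis indexed by the configurations. -/
abbrev RefSpace : Type := lp (fun _ : Config => ℂ) 2

/-- The involution exchanging the value at `v` with an external qubit value. -/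
def swapEquiv (v : Vertex) : Config × Fin 2 ≃ Config × Fin 2 where
  toFun p := (p.1.update v p.2, p.1 v)
  invFun p := (p.1.update v p.2, p.1 v)
  left_inv p := by ext w <;> simp [Finsupp.update_apply]
  right_inv p := by ext w <;> simp [Finsupp.update_apply]

theorem summable_sq (ψ : RefSpace) : Summable fun s : Config => ‖ψ s‖ ^ 2 := by
  simpa using (lp.memℓp ψ).summable (by norm_num)

theorem norm_sq_eq (ψ : RefSpace) : ‖ψ‖ ^ 2 = ∑' s : Config, ‖ψ s‖ ^ 2 := by
  simpa using lp.norm_rpow_eq_tsum (p := 2) (by norm_num) ψ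

theorem hasSum_prod_sq (ψ : RefSpace) :
    HasSum (fun p : Config × Fin 2 => ‖ψ p.1‖ ^ 2) (2 * ‖ψ‖ ^ 2) := by
  have hs : Summable (fun p : Config × Fin 2 => ‖ψ p.1‖ ^ 2) := by
    refine (summable_prod_of_nonneg (fun p => by positivity)).2
      ⟨fun _ => (hasSum_fintype _).summable, ?_⟩
    simpa using (summable_sq ψ).mul_left 2
  have := hs.hasSum
  rw [hs.tsum_prod] at this
  simpa [tsum_mul_left, norm_sq_eq ψ] using this

theorem hasSum_update (v : Vertex) (ψ : RefSpace) :
    HasSum (fun s : Config => ∑ j : Fin 2, ‖ψ (s.update v j)‖ ^ 2) (2 * ‖ψ‖ ^ 2) :=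
  ((swapEquiv v).hasSum_iff.2 (hasSum_prod_sq ψ)).prod_fiberwise fun s => hasSum_fintype _

theorem siteFun_bound (v : Vertex) (M : Matrix (Fin 2) (Fin 2) ℂ) (ψ : RefSpace) (s : Config) :
    ‖∑ j, M (s v) j * ψ (s.update v j)‖ ^ 2 ≤
      (∑ i, ∑ j, ‖M i j‖ ^ 2) * ∑ j : Fin 2, ‖ψ (s.update v j)‖ ^ 2 := by
  calc _ ≤ (∑ j, ‖M (s v) j‖ * ‖ψ (s.update v j)‖) ^ 2 := by
        gcongr
        exact (norm_sum_le _ _).trans_eq (by simp)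
    _ ≤ (∑ j, ‖M (s v) j‖ ^ 2) * ∑ j : Fin 2, ‖ψ (s.update v j)‖ ^ 2 :=
        Finset.sum_mul_sq_le_sq_mul_sq _ _ _
    _ ≤ _ := by
        refine mul_le_mul_of_nonneg_right ?_ (by positivity)
        exact Finset.single_le_sum (f := fun i => ∑ j, ‖M i j‖ ^ 2)
          (fun i _ => by positivity) (Finset.mem_univ _)

theorem siteFun_summable (v : Vertex) (M : Matrix (Fin 2) (Fin 2) ℂ) (ψ : RefSpace) :
    Summable fun s : Config => ‖∑ j, M (s v) j * ψ (s.update v j)‖ ^ 2 :=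
  .of_nonneg_of_le (fun _ => by positivity) (siteFun_bound v M ψ)
    ((hasSum_update v ψ).summable.mul_left _)

/-- The action of a `2 × 2` matrix on the qubit at `v`. -/
def siteLin (v : Vertex) (M : Matrix (Fin 2) (Fin 2) ℂ) : RefSpace →ₗ[ℂ] RefSpace where
  toFun ψ := ⟨fun s => ∑ j, M (s v) j * ψ (s.update v j),
    memℓp_gen (by simpa using siteFun_summable v M ψ)⟩
  map_add' ψ φ := by
    ext s
    simp only [lp.coeFn_add, Pi.add_apply, Fin.sum_univ_two]
    ring
  map_smul' a ψ := by
    ext s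
    simp
    try ring

theorem siteLin_apply (v : Vertex) (M : Matrix (Fin 2) (Fin 2) ℂ) (ψ : RefSpace) (s : Config) :
    siteLin v M ψ s = ∑ j, M (s v) j * ψ (s.update v j) := rfl

theorem siteLin_bound (v : Vertex) (M : Matrix (Fin 2) (Fin 2) ℂ) (ψ : RefSpace) :
    ‖siteLin v M ψ‖ ≤ √((∑ i, ∑ j, ‖M i j‖ ^ 2) * 2) * ‖ψ‖ := by
  have h0 : 0 ≤ ∑ i, ∑ j, ‖M i j‖ ^ 2 := by positivity
  refine (sq_le_sq₀ (by positivity) (by positivity)).1 ?_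
  rw [mul_pow, Real.sq_sqrt (by positivity), norm_sq_eq, mul_assoc,
    ← (hasSum_update v ψ).tsum_eq, ← tsum_mul_left]
  exact (siteFun_summable v M ψ).tsum_le_tsum (siteFun_bound v M ψ)
    ((hasSum_update v ψ).summable.mul_left _)

/-- `siteLin` as a bounded operator. -/
def siteCLM (v : Vertex) (M : Matrix (Fin 2) (Fin 2) ℂ) : RefSpace →L[ℂ] RefSpace :=
  (siteLin v M).mkContinuous _ (siteLin_bound v M)

theorem siteCLM_apply (v : Vertex) (M : Matrix (Fin 2) (Fin 2) ℂ) (ψ : RefSpace) (s : Config) :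
    siteCLM v M ψ s = ∑ j, M (s v) j * ψ (s.update v j) := rfl

theorem update_same (s : Config) (v : Vertex) (i : Fin 2) : (s.update v i) v = i := by
  simp

theorem update_twice (s : Config) (v : Vertex) (i j : Fin 2) :
    (s.update v i).update v j = s.update v j := by
  ext w; simp [Finsupp.update_apply]

theorem siteCLM_inner (v : Vertex) (M : Matrix (Fin 2) (Fin 2) ℂ) (ψ φ : RefSpace) :
    ⟪siteCLM v (star M) ψ, φ⟫_ℂ = ⟪ψ, siteCLM v M φ⟫_ℂ := by
  set G : Config × Fin 2 → ℂ := fun p =>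
    M (p.1 v) p.2 * φ (p.1.update v p.2) * (starRingEnd ℂ) (ψ p.1) with hG
  have hsum : Summable G := by
    have h1 := ((swapEquiv v).hasSum_iff.2 (hasSum_prod_sq φ)).summable
    have h2 := (hasSum_prod_sq ψ).summable
    refine .of_norm_bounded ((h1.add h2).mul_left (∑ i, ∑ j, ‖M i j‖)) fun p => ?_
    have hM : ‖M (p.1 v) p.2‖ ≤ ∑ i, ∑ j, ‖M i j‖ :=
      (Finset.single_le_sum (f := fun j => ‖M (p.1 v) j‖)
        (fun j _ => norm_nonneg _) (Finset.mem_univ p.2)).trans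
      (Finset.single_le_sum (f := fun i => ∑ j, ‖M i j‖)
        (fun i _ => by positivity) (Finset.mem_univ (p.1 v)))
    simp only [hG, norm_mul, RCLike.norm_conj, mul_assoc]
    refine mul_le_mul hM ?_ (by positivity) (by positivity)
    change ‖φ (p.1.update v p.2)‖ * ‖ψ p.1‖ ≤ ‖φ (p.1.update v p.2)‖ ^ 2 + ‖ψ p.1‖ ^ 2
    nlinarith [sq_nonneg (‖φ (p.1.update v p.2)‖ - ‖ψ p.1‖),
      sq_nonneg (‖φ (p.1.update v p.2)‖), sq_nonneg (‖ψ p.1‖)]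
  have h1 := hsum.hasSum.prod_fiberwise fun s => hasSum_fintype _
  have h2 := ((swapEquiv v).hasSum_iff.2 hsum.hasSum).prod_fiberwise fun s => hasSum_fintype _
  rw [lp.inner_eq_tsum, lp.inner_eq_tsum]
  refine Eq.trans ?_ (h2.tsum_eq.trans (h1.tsum_eq.symm.trans ?_))
  · refine tsum_congr fun s => ?_
    simp [siteCLM_apply, hG, swapEquiv, Matrix.star_apply]
    ring
  · refine tsum_congr fun s => ?_
    simp [siteCLM_apply, hG]
    ring

/-- The observables `M₂(ℂ)` of the qubit at `v`, acting on the tensor factor at `v`: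
`(M_v ψ)(s) = ∑ j, M (s v) j * ψ (s[v := j])`. -/
def siteOp (v : Vertex) : Matrix (Fin 2) (Fin 2) ℂ →⋆ₐ[ℂ] (RefSpace →L[ℂ] RefSpace) where
  toFun := siteCLM v
  map_one' := by
    ext ψ s
    simp [siteCLM_apply, Matrix.one_apply]
  map_mul' M N := by
    ext ψ s
    simp only [mul_apply_eq_comp, siteCLM_apply, update_same, update_twice,
      Matrix.mul_apply, Fin.sum_univ_two]
    ring
  map_zero' := by
    ext ψ s
    simp [siteCLM_apply]
  map_add' M N := by
    ext ψ s
    simp [siteCLM_apply, add_mul, Finset.sum_add_distrib]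
    try ring
  commutes' a := by
    ext ψ s
    simp [siteCLM_apply, Matrix.algebraMap_matrix_apply]
  map_star' M := by
    refine (ContinuousLinearMap.eq_adjoint_iff _ _).2 fun ψ φ => ?_
    exact siteCLM_inner v M ψ φ

theorem siteOp_apply (v : Vertex) (M : Matrix (Fin 2) (Fin 2) ℂ) (ψ : RefSpace) (s : Config) :
    siteOp v M ψ s = ∑ j, M (s v) j * ψ (s.update v j) := rfl

theorem siteOp_comm {v w : Vertex} (h : v ≠ w) (M N : Matrix (Fin 2) (Fin 2) ℂ) :
    siteOp v M * siteOp w N = siteOp w N * siteOp v M := by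
  ext ψ s
  have hu : ∀ i j : Fin 2, (s.update v i).update w j = (s.update w j).update v i := by
    intro i j
    ext x
    by_cases h1 : x = v <;> by_cases h2 : x = w <;> simp_all [Finsupp.update_apply]
  have hw : ∀ i : Fin 2, (s.update v i) w = s w := fun i => by
    simp [Finsupp.update_apply, h.symm]
  have hv : ∀ i : Fin 2, (s.update w i) v = s v := fun i => by
    simp [Finsupp.update_apply, h]
  simp only [mul_apply_eq_comp, siteOp_apply, hu, hv, hw, Fin.sum_univ_two]
  ring


/-- The quasi-local algebra: the norm closure of the local observables. Local observables are
the algebra generated by the commuting copies `siteOp v` of `M₂(ℂ)`, so the part generated by the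
sites of a finite set `Λ` is `⨂_{v ∈ Λ} M₂(ℂ)`; this algebra acts faithfully on the reference
space, hence isometrically, and the norm closure is the C⋆-inductive limit. -/
def QuasiLocal : Type :=
  ↥(StarAlgebra.adjoin ℂ {T | ∃ (v : Vertex) (M : Matrix (Fin 2) (Fin 2) ℂ),
    T = siteOp v M}).topologicalClosure

/-- The quasi-local algebra is a C⋆-algebra, being closed in the bounded operators. -/
def QuasiLocal.cstarAlgebra : CStarAlgebra QuasiLocal :=
  StarSubalgebra.cstarAlgebra
    (h_closed := StarSubalgebra.isClosed_topologicalClosure _) _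

instance : CStarAlgebra QuasiLocal := QuasiLocal.cstarAlgebra

/-- The order whose positive elements are the elements `star a * a`. -/
instance : PartialOrder QuasiLocal := CStarAlgebra.spectralOrder QuasiLocal

instance : StarOrderedRing QuasiLocal := CStarAlgebra.spectralOrderedRing QuasiLocal

/-- The inclusion of the quasi-local algebra into the bounded operators. -/
def toOp : QuasiLocal →⋆ₐ[ℂ] (RefSpace →L[ℂ] RefSpace) :=
  StarSubalgebra.subtype _

theorem siteOp_mem (v : Vertex) (M : Matrix (Fin 2) (Fin 2) ℂ) :
    siteOp v M ∈ (StarAlgebra.adjoin ℂ {T | ∃ (v : Vertex) (M : Matrix (Fin 2) (Fin 2) ℂ),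
      T = siteOp v M}).topologicalClosure :=
  StarSubalgebra.le_topologicalClosure _ (StarAlgebra.subset_adjoin ℂ _ ⟨v, M, rfl⟩)

/-- The observables of the qubit at `v` inside the quasi-local algebra. -/
def site (v : Vertex) : Matrix (Fin 2) (Fin 2) ℂ →⋆ₐ[ℂ] QuasiLocal :=
  StarAlgHom.codRestrict (siteOp v) _ (siteOp_mem v)

/-- The union of the algebras `𝒜(Λ')` over the finite subsets `Λ'` of `Λ`. -/
def strictlyLocalAlgebra (Λ : Set Vertex) : StarSubalgebra ℂ QuasiLocal :=
  StarAlgebra.adjoin ℂ {a | ∃ v ∈ Λ, ∃ M : Matrix (Fin 2) (Fin 2) ℂ, a = site v M}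

/-- The algebra `𝒜(Λ)` of observables localized in `Λ`. -/
def localAlgebra (Λ : Set Vertex) : StarSubalgebra ℂ QuasiLocal :=
  (strictlyLocalAlgebra Λ).topologicalClosure

theorem toOp_injective : Function.Injective toOp := Subtype.val_injective

theorem isometry_toOp : Isometry toOp := isometry_subtype_coe

theorem toOp_site (v : Vertex) (M : Matrix (Fin 2) (Fin 2) ℂ) : toOp (site v M) = siteOp v M := rfl

theorem site_comm {v w : Vertex} (h : v ≠ w) (M N : Matrix (Fin 2) (Fin 2) ℂ) :
    site v M * site w N = site w N * site v M :=
  toOp_injective (by simpa [toOp_site] using siteOp_comm h M N)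

theorem localAlgebra_univ : localAlgebra Set.univ = ⊤ := by
  refine eq_top_iff.2 fun a _ => ?_
  change a ∈ closure (strictlyLocalAlgebra Set.univ : Set QuasiLocal)
  refine Metric.mem_closure_iff.2 fun ε hε => ?_
  have ha : toOp a ∈ closure ((StarAlgebra.adjoin ℂ
      {T | ∃ (v : Vertex) (M : Matrix (Fin 2) (Fin 2) ℂ), T = siteOp v M} :
        StarSubalgebra ℂ (RefSpace →L[ℂ] RefSpace)) : Set (RefSpace →L[ℂ] RefSpace)) := a.2
  obtain ⟨T, hT, hd⟩ := Metric.mem_closure_iff.1 ha ε hε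
  have hmap : (strictlyLocalAlgebra Set.univ).map toOp = StarAlgebra.adjoin ℂ
      {T | ∃ (v : Vertex) (M : Matrix (Fin 2) (Fin 2) ℂ), T = siteOp v M} := by
    rw [strictlyLocalAlgebra, StarAlgHom.map_adjoin]
    congr 1
    ext T
    constructor
    · rintro ⟨_, ⟨v, -, M, rfl⟩, rfl⟩
      exact ⟨v, M, rfl⟩
    · rintro ⟨v, M, rfl⟩
      exact ⟨site v M, ⟨v, trivial, M, rfl⟩, rfl⟩
  rw [← hmap] at hT
  obtain ⟨b, hb, rfl⟩ := hT
  exact ⟨b, hb, by rwa [← isometry_toOp.dist_eq]⟩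

/-- The three colors. -/
inductive Color | r | g | b

/-- The three Pauli types. -/
inductive Pauli | x | y | z

def sigmaX : Matrix (Fin 2) (Fin 2) ℂ := !![0, 1; 1, 0]
def sigmaZ : Matrix (Fin 2) (Fin 2) ℂ := !![1, 0; 0, -1]

/-- The product of the matrix `M` placed on the vertices of the list. -/
def siteProd (M : Matrix (Fin 2) (Fin 2) ℂ) (l : List Vertex) : QuasiLocal :=
  (l.map fun v => site v M).prod

/-- The string operator of type `k` on a sequence of vertices. When no vertex is repeated this is
the tensor product of Pauli matrices over the vertices of the string. -/
def stringOp : Pauli → List Vertex → QuasiLocal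
  | .x, l => siteProd sigmaX l
  | .y, l => siteProd sigmaX l * siteProd sigmaZ l
  | .z, l => siteProd sigmaZ l

/-- A face (brick), given by its lower left corner `(col, row)`; it is two units wide and one high. -/
structure Face where
  col : ℤ
  row : ℤ
  odd : Odd (col + row)

/-- The six vertices of a face. -/
def Face.boundary (f : Face) : List Vertex :=
  [(f.col, f.row), (f.col + 1, f.row), (f.col + 2, f.row),
   (f.col, f.row + 1), (f.col + 1, f.row + 1), (f.col + 2, f.row + 1)]

/-- The stabilizer `K_f`. -/
def Face.K (f : Face) : QuasiLocal := siteProd sigmaX f.boundary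

/-- The stabilizer `J_f`. -/
def Face.J (f : Face) : QuasiLocal := siteProd sigmaZ f.boundary

/-- The three-coloring of the faces (adjacent faces have corners differing by `(±2, 0)` or
`(±1, ±1)`, hence different colors). -/
def Face.color (f : Face) : Color :=
  if f.col % 3 = 0 then .r else if f.col % 3 = 1 then .g else .b

/-- The edges: all horizontal unit segments, and the vertical unit segments whose lower end has
odd coordinate sum. -/
def IsEdge (v w : Vertex) : Prop :=
  (v.2 = w.2 ∧ (w.1 = v.1 + 1 ∨ v.1 = w.1 + 1)) ∨
  (v.1 = w.1 ∧ ((Odd (v.1 + v.2) ∧ w.2 = v.2 + 1) ∨ (Odd (w.1 + w.2) ∧ v.2 = w.2 + 1)))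

/-- The edge from `v` to `w` connects the face `f` to the face `g`: it leaves `f` at `v` and
arrives in `g` at `w`. An edge has color `c` when it connects two faces of color `c`. -/
structure Connects (v w : Vertex) (f g : Face) : Prop where
  edge : IsEdge v w
  mem_left : v ∈ f.boundary
  mem_right : w ∈ g.boundary
  not_mem_left : v ∉ g.boundary
  not_mem_right : w ∉ f.boundary

/-- A half-infinite string `(f₀, v₀, v₁, f₁, v₂, v₃, f₂, …)` of color `c`: the edge from `v₂ᵢ` to
`v₂ᵢ₊₁` connects the `c`-colored faces `fᵢ` and `fᵢ₊₁`, and the string leaves every finite region,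
that is, it passes through each vertex only finitely often. -/
structure HalfInfiniteString (c : Color) where
  face : ℕ → Face
  vtx : ℕ → Vertex
  color_face : ∀ i, (face i).color = c
  connects : ∀ i, Connects (vtx (2 * i)) (vtx (2 * i + 1)) (face i) (face (i + 1))
  finite_visits : ∀ v, {n | vtx n = v}.Finite

variable {c : Color}

/-- The vertices of the finite string formed by the first `n` faces. -/
def HalfInfiniteString.trunc (γ : HalfInfiniteString c) (n : ℕ) : List Vertex :=
  (List.range (2 * (n - 1))).map γ.vtx

/-- Conjugation by the string operator of the truncated string. -/
def HalfInfiniteString.conj (γ : HalfInfiniteString c) (k : Pauli) (n : ℕ) (a : QuasiLocal) :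
    QuasiLocal :=
  star (stringOp k (γ.trunc n)) * a * stringOp k (γ.trunc n)

theorem siteProd_conj {P : Matrix (Fin 2) (Fin 2) ℂ} (hP : star P * P = 1) (l : List Vertex)
    (v : Vertex) (M : Matrix (Fin 2) (Fin 2) ℂ) :
    star (siteProd P l) * site v M * siteProd P l
      = site v (star (P ^ l.count v) * M * P ^ l.count v) := by
  induction l generalizing M with
  | nil => simp [siteProd]
  | cons w l ih =>
    have h : siteProd P (w :: l) = site w P * siteProd P l := by simp [siteProd]
    have h2 : star (siteProd P (w :: l)) * site v M * siteProd P (w :: l)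
        = star (siteProd P l) * (star (site w P) * site v M * site w P) * siteProd P l := by
      rw [h, star_mul]; simp only [mul_assoc]
    rw [h2, ← map_star]
    by_cases hvw : v = w
    · subst hvw
      rw [← map_mul, ← map_mul, ih, List.count_cons_self, pow_succ']
      simp only [star_mul, mul_assoc]
    · rw [mul_assoc (site w (star P)), site_comm hvw, ← mul_assoc (site w (star P)), ← map_mul, hP, map_one, one_mul, ih,
        List.count_cons_of_ne (Ne.symm hvw)]

theorem siteProd_unitary {P : Matrix (Fin 2) (Fin 2) ℂ} (hP : star P * P = 1) (l : List Vertex) :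
    siteProd P l ∈ unitary QuasiLocal := by
  have hP' : P ∈ unitary (Matrix (Fin 2) (Fin 2) ℂ) := ⟨hP, mul_eq_one_comm.1 hP⟩
  refine Submonoid.list_prod_mem _ fun a ha => ?_
  obtain ⟨v, -, rfl⟩ := List.mem_map.1 ha
  exact Unitary.map_mem (site v) hP'

theorem sigmaX_sq : star sigmaX * sigmaX = 1 := by
  ext i j; fin_cases i <;> fin_cases j <;> simp [sigmaX, Matrix.star_apply, Matrix.mul_apply]

theorem sigmaZ_sq : star sigmaZ * sigmaZ = 1 := by
  ext i j; fin_cases i <;> fin_cases j <;> simp [sigmaZ, Matrix.star_apply, Matrix.mul_apply]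

theorem stringOp_unitary (k : Pauli) (l : List Vertex) : stringOp k l ∈ unitary QuasiLocal := by
  cases k
  · exact siteProd_unitary sigmaX_sq l
  · exact mul_mem (siteProd_unitary sigmaX_sq l) (siteProd_unitary sigmaZ_sq l)
  · exact siteProd_unitary sigmaZ_sq l

theorem stringOp_conj_congr (k : Pauli) {l l' : List Vertex} {v : Vertex}
    (h : l.count v = l'.count v) (M : Matrix (Fin 2) (Fin 2) ℂ) :
    star (stringOp k l) * site v M * stringOp k l
      = star (stringOp k l') * site v M * stringOp k l' := by
  cases k
  · simp only [stringOp, siteProd_conj sigmaX_sq, h]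
  · have e : ∀ l, star (stringOp .y l) * site v M * stringOp .y l
        = star (siteProd sigmaZ l) * (star (siteProd sigmaX l) * site v M * siteProd sigmaX l)
          * siteProd sigmaZ l := fun l => by
      simp only [stringOp, star_mul, mul_assoc]
    simp only [e, siteProd_conj sigmaX_sq, siteProd_conj sigmaZ_sq, h]
  · simp only [stringOp, siteProd_conj sigmaZ_sq, h]

namespace HalfInfiniteString

variable (γ : HalfInfiniteString c) (k : Pauli)

theorem conj_add (n : ℕ) (a b : QuasiLocal) : γ.conj k n (a + b) = γ.conj k n a + γ.conj k n b := by
  simp [conj, mul_add, add_mul]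

theorem conj_sub (n : ℕ) (a b : QuasiLocal) : γ.conj k n (a - b) = γ.conj k n a - γ.conj k n b := by
  simp [conj, mul_sub, sub_mul]

theorem conj_mul (n : ℕ) (a b : QuasiLocal) : γ.conj k n (a * b) = γ.conj k n a * γ.conj k n b := by
  have h := (stringOp_unitary k (γ.trunc n)).2
  simp only [conj, mul_assoc]
  rw [← mul_assoc (stringOp k (γ.trunc n)) (star _), h, one_mul]

theorem conj_star (n : ℕ) (a : QuasiLocal) : γ.conj k n (star a) = star (γ.conj k n a) := by
  simp [conj, mul_assoc]

theorem conj_algebraMap (n : ℕ) (r : ℂ) :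
    γ.conj k n (algebraMap ℂ QuasiLocal r) = algebraMap ℂ QuasiLocal r := by
  rw [conj, ← Algebra.commutes, mul_assoc, (stringOp_unitary k (γ.trunc n)).1, mul_one]

theorem norm_conj (n : ℕ) (a : QuasiLocal) : ‖γ.conj k n a‖ = ‖a‖ := by
  have h := stringOp_unitary k (γ.trunc n)
  rw [conj, CStarRing.norm_mul_mem_unitary _ h,
    CStarRing.norm_mem_unitary_mul _ (Unitary.star_mem h)]

theorem eventually_count (v : Vertex) :
    ∃ N, ∀ n ≥ N, (γ.trunc n).count v = (γ.trunc N).count v := by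
  obtain ⟨B, hB⟩ := (γ.finite_visits v).bddAbove
  refine ⟨B + 2, fun n hn => ?_⟩
  obtain ⟨m, rfl⟩ := Nat.exists_eq_add_of_le hn
  have e : 2 * (B + 2 + m - 1) = 2 * (B + 2 - 1) + 2 * m := by omega
  rw [trunc, trunc, e, List.range_add, List.map_append, List.count_append, Nat.add_eq_left,
    List.count_eq_zero]
  intro hv
  simp only [List.map_map, List.mem_map, List.mem_range, Function.comp_apply] at hv
  obtain ⟨j, -, hj⟩ := hv
  have := hB (show 2 * (B + 2 - 1) + j ∈ {n | γ.vtx n = v} from hj)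
  omega

theorem conj_eventually_const {a : QuasiLocal} (ha : a ∈ strictlyLocalAlgebra Set.univ) :
    ∃ N, ∀ n ≥ N, γ.conj k n a = γ.conj k N a := by
  induction ha using StarAlgebra.adjoin_induction with
  | mem a ha =>
    obtain ⟨v, -, M, rfl⟩ := ha
    obtain ⟨N, hN⟩ := γ.eventually_count v
    exact ⟨N, fun n hn => stringOp_conj_congr k (hN n hn) M⟩
  | algebraMap r => exact ⟨0, fun n _ => by simp only [conj_algebraMap]⟩
  | add a b _ _ iha ihb =>
    obtain ⟨N, hN⟩ := iha
    obtain ⟨N', hN'⟩ := ihb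
    refine ⟨max N N', fun n hn => ?_⟩
    rw [conj_add, conj_add, hN n (le_of_max_le_left hn), hN' n (le_of_max_le_right hn),
      hN _ (le_max_left _ _), hN' _ (le_max_right _ _)]
  | mul a b _ _ iha ihb =>
    obtain ⟨N, hN⟩ := iha
    obtain ⟨N', hN'⟩ := ihb
    refine ⟨max N N', fun n hn => ?_⟩
    rw [conj_mul, conj_mul, hN n (le_of_max_le_left hn), hN' n (le_of_max_le_right hn),
      hN _ (le_max_left _ _), hN' _ (le_max_right _ _)]
  | star a _ ih =>
    obtain ⟨N, hN⟩ := ih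
    exact ⟨N, fun n hn => by rw [conj_star, conj_star, hN n hn]⟩

theorem exists_tendsto_conj (a : QuasiLocal) :
    ∃ b, Tendsto (fun n => γ.conj k n a) atTop (𝓝 b) := by
  refine cauchySeq_tendsto_of_complete (Metric.cauchySeq_iff'.2 fun ε hε => ?_)
  have ha : a ∈ closure (strictlyLocalAlgebra Set.univ : Set QuasiLocal) := by
    have : a ∈ localAlgebra Set.univ := by rw [localAlgebra_univ]; trivial
    exact this
  obtain ⟨b, hb, hab⟩ := Metric.mem_closure_iff.1 ha (ε / 2) (by positivity)
  obtain ⟨N, hN⟩ := γ.conj_eventually_const k hb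
  refine ⟨N, fun n hn => ?_⟩
  have h : ∀ n, dist (γ.conj k n a) (γ.conj k n b) < ε / 2 := fun n => by
    rw [dist_eq_norm, ← conj_sub, norm_conj, ← dist_eq_norm]; exact hab
  calc _ ≤ dist (γ.conj k n a) (γ.conj k n b) + dist (γ.conj k n b) (γ.conj k N a) :=
        dist_triangle _ _ _
    _ < ε / 2 + ε / 2 := by
        refine add_lt_add (h n) ?_
        rw [hN n hn, dist_comm]
        exact h N
    _ = ε := add_halves ε

/-- The norm limit of the conjugations by the truncated string operators. -/
def endoFun (a : QuasiLocal) : QuasiLocal := (γ.exists_tendsto_conj k a).choose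

theorem tendsto_conj (a : QuasiLocal) :
    Tendsto (fun n => γ.conj k n a) atTop (𝓝 (γ.endoFun k a)) :=
  (γ.exists_tendsto_conj k a).choose_spec

theorem endoFun_eq {a b : QuasiLocal} (h : Tendsto (fun n => γ.conj k n a) atTop (𝓝 b)) :
    γ.endoFun k a = b :=
  tendsto_nhds_unique (γ.tendsto_conj k a) h

theorem endoFun_algebraMap (r : ℂ) :
    γ.endoFun k (algebraMap ℂ QuasiLocal r) = algebraMap ℂ QuasiLocal r :=
  γ.endoFun_eq k (by simp only [conj_algebraMap]; exact tendsto_const_nhds)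

/-- The endomorphism `ρ_γ^{ck}`. -/
def endo : QuasiLocal →⋆ₐ[ℂ] QuasiLocal where
  toFun := γ.endoFun k
  map_one' := by simpa using γ.endoFun_algebraMap k 1
  map_mul' a b := γ.endoFun_eq k (by
    simp only [conj_mul]; exact (γ.tendsto_conj k a).mul (γ.tendsto_conj k b))
  map_zero' := by simpa using γ.endoFun_algebraMap k 0
  map_add' a b := γ.endoFun_eq k (by
    simp only [conj_add]; exact (γ.tendsto_conj k a).add (γ.tendsto_conj k b))
  commutes' := γ.endoFun_algebraMap k
  map_star' a := γ.endoFun_eq k (by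
    simp only [conj_star]; exact (γ.tendsto_conj k a).star)

end HalfInfiniteString

/-- Positive linear functionals on the quasi-local algebra. -/
abbrev Functional : Type := QuasiLocal →ₚ[ℂ] ℂ

/-- The functional is a state taking the value `1` on all the stabilizers. This determines the
ground state of the model. -/
def IsVacuum (ω : Functional) : Prop :=
  ω 1 = 1 ∧ ∀ f : Face, ω f.K = 1 ∧ ω f.J = 1

/-- The state `ω ∘ ρ_γ^{ck}`. -/
def stringState (ω : Functional) (γ : HalfInfiniteString c) (k : Pauli) :
    Functional :=
  ω.comp (PositiveLinearMap.ofClass (γ.endo k))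

/-- Representations of the quasi-local algebra on a Hilbert space. -/
abbrev Rep (H : Type*) [NormedAddCommGroup H] [InnerProductSpace ℂ H] [CompleteSpace H] :=
  QuasiLocal →⋆ₐ[ℂ] (H →L[ℂ] H)

/-- The GNS representation of a positive functional. -/
abbrev gns (ω : Functional) : Rep ω.GNS := ω.gnsStarAlgHom

/-- Unitary equivalence of the restrictions of two representations to a subalgebra. -/
def EquivalentOn {H₁ H₂ : Type*} [NormedAddCommGroup H₁] [InnerProductSpace ℂ H₁]
    [CompleteSpace H₁] [NormedAddCommGroup H₂] [InnerProductSpace ℂ H₂] [CompleteSpace H₂]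
    (B : StarSubalgebra ℂ QuasiLocal) (π₁ : Rep H₁) (π₂ : Rep H₂) : Prop :=
  ∃ U : H₁ ≃ₗᵢ[ℂ] H₂, ∀ a ∈ B, ∀ x, U (π₁ a x) = π₂ a (U x)

/-- Unitary equivalence of two representations. -/
def Equivalent {H₁ H₂ : Type*} [NormedAddCommGroup H₁] [InnerProductSpace ℂ H₁]
    [CompleteSpace H₁] [NormedAddCommGroup H₂] [InnerProductSpace ℂ H₂] [CompleteSpace H₂]
    (π₁ : Rep H₁) (π₂ : Rep H₂) : Prop :=
  ∃ U : H₁ ≃ₗᵢ[ℂ] H₂, ∀ a x, U (π₁ a x) = π₂ a (U x)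

/-- The position of a vertex in the plane. -/
def position (v : Vertex) : EuclideanSpace ℝ (Fin 2) := !₂[(v.1 : ℝ), (v.2 : ℝ)]

/-- A cone of vertices: the vertices in an open cone with apex `p`, axis `a` and half-opening
angle `θ`. -/
def IsCone (Λ : Set Vertex) : Prop :=
  ∃ (p a : EuclideanSpace ℝ (Fin 2)) (θ : ℝ), ‖a‖ = 1 ∧ 0 < θ ∧ θ < Real.pi ∧
    Λ = {v | ‖position v - p‖ * Real.cos θ < ⟪position v - p, a⟫_ℝ}

/-- The superselection criterion relative to the GNS representation of `ω₀`: outside any cone the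
representation is unitarily equivalent to that of `ω₀`. -/
def SatisfiesSuperselection (ω₀ : Functional) {H : Type*} [NormedAddCommGroup H]
    [InnerProductSpace ℂ H] [CompleteSpace H] (π : Rep H) : Prop :=
  ∀ Λ : Set Vertex, IsCone Λ → EquivalentOn (localAlgebra Λᶜ) π (gns ω₀)

end
end ColorCode

/-! Everything is reduced to finite chains modulo 2. The Pauli products `X a * Z b` span a dense
subspace, and `X a`, `Z b` commute up to the sign of `pair a b`. A state is therefore known from its
values on these products.

The combinatorial core is `mem_faceSpan_iff`: in the plane, a finite chain that meets every face
evenly is a sum of face boundaries. If `a` and `b` are such sums, the stabilizers force `ω (X a * Z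
b) = 1`; otherwise some stabilizer anticommutes with the product and the value is 0. This gives
uniqueness of the vacuum. Existence comes from a limit of vector states, obtained by applying
products of the `1 + K_f` to the all-zero vector.

Conjugation by strings of type `k` multiplies `X a * Z b` by the sign of `φ (sel k a b)` for a
homomorphism `φ` on chains (`IsTwist`). For a half-infinite string, `φ` is 1 on the boundary of the
starting face and 0 on that of every other face (`endo_isTwist`). The vacuum sees only `faceSpan`,
so the string state depends only on `k` and that face, and any other twist with the same face values
yields the same state. A finite string between two faces of one color is a local unitary that moves
the charge; this makes the GNS representations equivalent (`equivalent_twist`).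

For the superselection criterion, the charge is moved to a twist `ρ` supported in the given cone.
Its state is a vector state of `π₀ ∘ ρ` with cyclic vector, and `ρ` is the identity outside the
cone.

Different types are separated by loops around large regions. If finitely many faces cover a finite
region exactly once in each color, the sum of the boundaries of those of two colors vanishes on the
region, lies in `faceSpan`, and detects whether the enclosed charge has one of the two colors
(`exists_loop`). The loop operators of type `X` and `Z` have value ±1 in the string states and
commute with observables of the region, so unitary equivalence forces the signs to agree
(`charge_eq`). These signs determine color and Pauli type. -/

namespace ColorCode
open scoped ComplexOrder InnerProductSpace
open Filter Topology
noncomputable section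

open scoped Fin.CommRing

/-! ### Pauli products indexed by chains modulo 2. -/

/-- The `ℤ/2`-chain of a list of vertices. -/
def chain (l : List Vertex) : Config := (l.map fun v => Finsupp.single v (1 : Fin 2)).sum

@[simp] theorem chain_nil : chain [] = 0 := rfl

@[simp] theorem chain_cons (v : Vertex) (l : List Vertex) :
    chain (v :: l) = Finsupp.single v 1 + chain l := by simp [chain]

@[simp] theorem chain_append (l m : List Vertex) : chain (l ++ m) = chain l + chain m := by
  simp [chain]

theorem chain_apply (l : List Vertex) (v : Vertex) : chain l v = (l.count v : Fin 2) := by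
  induction l with
  | nil => simp
  | cons w l ih =>
    by_cases h : w = v <;> simp [ih, h, add_comm]

theorem chain_support (a : Config) : chain a.support.toList = a := by
  classical
  ext v : 1
  rw [chain_apply, List.Nodup.count (Finset.nodup_toList _)]
  by_cases h : a v = 0
  · simp [h]
  · have : a v = 1 := by revert h; generalize a v = x; decide +revert
    simp [this]

/-- The pairing of chains with values in `ℤ/2`. -/
def pair (a : Config) : Config →+ Fin 2 :=
  Finsupp.liftAddHom fun v => AddMonoidHom.mulLeft (a v)

@[simp] theorem pair_single (a : Config) (v : Vertex) (x : Fin 2) :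
    pair a (Finsupp.single v x) = a v * x := by simp [pair]

@[simp] theorem pair_add_left (a b c : Config) : pair (a + b) c = pair a c + pair b c := by
  induction c using Finsupp.induction_linear with
  | zero => simp
  | add f g hf hg => simp only [map_add, hf, hg]; abel
  | single v x => simp [add_mul]

@[simp] theorem pair_zero_left (c : Config) : pair 0 c = 0 := by
  induction c using Finsupp.induction_linear with
  | zero => simp
  | add f g hf hg => simp [hf, hg]
  | single v x => simp

theorem pair_comm (a c : Config) : pair a c = pair c a := by
  induction c using Finsupp.induction_linear with
  | zero => simp
  | add f g hf hg => simp [hf, hg]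
  | single v x =>
    rw [pair_single]
    induction a using Finsupp.induction_linear with
    | zero => simp
    | add f g hf hg => simp [← hf, ← hg, add_mul]
    | single w y =>
      by_cases h : v = w
      · simp [h, mul_comm]
      · simp [h, Ne.symm h]

theorem pair_chain (l : List Vertex) (c : Config) : pair (chain l) c = (l.map c).sum := by
  rw [pair_comm]
  induction l with
  | nil => simp
  | cons v l ih => simp [ih]

theorem fin_two_add_self (x : Fin 2) : x + x = 0 := by decide +revert

theorem config_add_self (a : Config) : a + a = 0 := by
  ext v : 1
  simp [fin_two_add_self]

/-- The sign `(-1) ^ x`. -/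
def sgn (x : Fin 2) : ℂ := if x = 0 then 1 else -1

@[simp] theorem sgn_zero : sgn 0 = 1 := rfl
@[simp] theorem sgn_one : sgn 1 = -1 := rfl

theorem fin_two_cases (x : Fin 2) : x = 0 ∨ x = 1 := by decide +revert

theorem sgn_add (x y : Fin 2) : sgn (x + y) = sgn x * sgn y := by
  rcases fin_two_cases x with rfl | rfl <;> rcases fin_two_cases y with rfl | rfl <;>
    simp [fin_two_add_self]

@[simp] theorem sgn_mul_self (x : Fin 2) : sgn x * sgn x = 1 := by
  rcases fin_two_cases x with rfl | rfl <;> simp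

theorem siteOp_sigmaX_apply (v : Vertex) (ψ : RefSpace) (s : Config) :
    siteOp v sigmaX ψ s = ψ (s + Finsupp.single v 1) := by
  have h : ∀ x, s.update v x = s + Finsupp.single v (x + s v) := by
    intro x
    ext w : 1
    by_cases hw : w = v
    · subst hw
      simp only [Finsupp.update_apply, if_true, Finsupp.add_apply, Finsupp.single_eq_same]
      generalize s w = y; decide +revert
    · simp [Finsupp.update_apply, hw]
  rw [siteOp_apply]
  simp only [h, Fin.sum_univ_two]
  rcases fin_two_cases (s v) with h0 | h0 <;> simp [h0, sigmaX]

theorem siteOp_sigmaZ_apply (v : Vertex) (ψ : RefSpace) (s : Config) :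
    siteOp v sigmaZ ψ s = sgn (s v) * ψ s := by
  have h : s.update v (s v) = s := by
    ext w : 1
    by_cases hw : w = v <;> simp [hw]
  rw [siteOp_apply]
  rcases fin_two_cases (s v) with h0 | h0 <;> rw [h0] at h ⊢ <;> simp [sigmaZ, h]

theorem toOp_siteProd_sigmaX (l : List Vertex) (ψ : RefSpace) (s : Config) :
    toOp (siteProd sigmaX l) ψ s = ψ (s + chain l) := by
  induction l generalizing s with
  | nil => simp [siteProd]
  | cons v l ih =>
    have h : siteProd sigmaX (v :: l) = site v sigmaX * siteProd sigmaX l := by simp [siteProd]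
    rw [h, map_mul, toOp_site, mul_apply_eq_comp, siteOp_sigmaX_apply, ih, chain_cons, add_assoc]

theorem toOp_siteProd_sigmaZ (l : List Vertex) (ψ : RefSpace) (s : Config) :
    toOp (siteProd sigmaZ l) ψ s = sgn (pair s (chain l)) * ψ s := by
  induction l generalizing s with
  | nil => simp [siteProd]
  | cons v l ih =>
    have h : siteProd sigmaZ (v :: l) = site v sigmaZ * siteProd sigmaZ l := by simp [siteProd]
    rw [h, map_mul, toOp_site, mul_apply_eq_comp, siteOp_sigmaZ_apply, ih, chain_cons,
      map_add, sgn_add, pair_single, mul_one, mul_assoc]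

/-- The product of the operators `σˣ` over a chain. -/
def X (a : Config) : QuasiLocal := siteProd sigmaX a.support.toList

/-- The product of the operators `σᶻ` over a chain. -/
def Z (a : Config) : QuasiLocal := siteProd sigmaZ a.support.toList

theorem X_apply (a : Config) (ψ : RefSpace) (s : Config) : toOp (X a) ψ s = ψ (s + a) := by
  rw [X, toOp_siteProd_sigmaX, chain_support]

theorem Z_apply (a : Config) (ψ : RefSpace) (s : Config) :
    toOp (Z a) ψ s = sgn (pair s a) * ψ s := by
  rw [Z, toOp_siteProd_sigmaZ, chain_support]

theorem quasiLocal_ext {A B : QuasiLocal} (h : ∀ ψ s, toOp A ψ s = toOp B ψ s) : A = B :=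
  toOp_injective (by ext ψ s; exact h ψ s)

theorem siteProd_sigmaX (l : List Vertex) : siteProd sigmaX l = X (chain l) :=
  quasiLocal_ext fun ψ s => by rw [toOp_siteProd_sigmaX, X_apply]

theorem siteProd_sigmaZ (l : List Vertex) : siteProd sigmaZ l = Z (chain l) :=
  quasiLocal_ext fun ψ s => by rw [toOp_siteProd_sigmaZ, Z_apply]

theorem X_add (a b : Config) : X (a + b) = X a * X b :=
  quasiLocal_ext fun ψ s => by rw [map_mul, mul_apply_eq_comp]; simp only [X_apply, add_assoc]

theorem Z_add (a b : Config) : Z (a + b) = Z a * Z b :=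
  quasiLocal_ext fun ψ s => by
    rw [map_mul, mul_apply_eq_comp]
    simp only [Z_apply, map_add, sgn_add, mul_assoc]

@[simp] theorem X_zero : X 0 = 1 := by simp [X, siteProd]
@[simp] theorem Z_zero : Z 0 = 1 := by simp [Z, siteProd]

theorem Z_mul_X (a b : Config) : Z b * X a = sgn (pair a b) • (X a * Z b) :=
  quasiLocal_ext fun ψ s => by
    simp only [map_mul, map_smul, mul_apply_eq_comp]
    change _ = sgn (pair a b) * (toOp (X a) (toOp (Z b) ψ) s)
    simp only [X_apply, Z_apply, pair_add_left, sgn_add]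
    linear_combination (- sgn (pair s b) * ψ (s + a)) * sgn_mul_self (pair a b)

theorem X_mul_self (a : Config) : X a * X a = 1 := by rw [← X_add, config_add_self, X_zero]
theorem Z_mul_self (a : Config) : Z a * Z a = 1 := by rw [← Z_add, config_add_self, Z_zero]

theorem star_X (a : Config) : star (X a) = X a := by
  have h := (siteProd_unitary sigmaX_sq a.support.toList).1
  exact left_inv_eq_right_inv h (X_mul_self a)

theorem star_Z (a : Config) : star (Z a) = Z a := by
  have h := (siteProd_unitary sigmaZ_sq a.support.toList).1
  exact left_inv_eq_right_inv h (Z_mul_self a)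

theorem site_sigmaX (v : Vertex) : site v sigmaX = X (Finsupp.single v 1) := by
  simpa [siteProd] using siteProd_sigmaX [v]

theorem site_sigmaZ (v : Vertex) : site v sigmaZ = Z (Finsupp.single v 1) := by
  simpa [siteProd] using siteProd_sigmaZ [v]

/-- The matrices `1`, `sigmaX`, `sigmaZ`, `sigmaX * sigmaZ` form a basis of the 2 × 2 matrices; the
last one is antisymmetric, which explains the difference in its coefficient. -/
theorem site_eq (v : Vertex) (M : Matrix (Fin 2) (Fin 2) ℂ) :
    site v M = ((M 0 0 + M 1 1) / 2) • 1 + ((M 0 1 + M 1 0) / 2) • X (Finsupp.single v 1)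
      + ((M 0 0 - M 1 1) / 2) • Z (Finsupp.single v 1)
      + ((M 1 0 - M 0 1) / 2) • (X (Finsupp.single v 1) * Z (Finsupp.single v 1)) := by
  have h : M = ((M 0 0 + M 1 1) / 2) • 1 + ((M 0 1 + M 1 0) / 2) • sigmaX
      + ((M 0 0 - M 1 1) / 2) • sigmaZ + ((M 1 0 - M 0 1) / 2) • (sigmaX * sigmaZ) := by
    ext i j
    fin_cases i <;> fin_cases j <;> simp [sigmaX, sigmaZ] <;> ring
  conv_lhs => rw [h]
  simp only [map_add, map_smul, map_mul, map_one, site_sigmaX, site_sigmaZ]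

/-- The products `X a * Z b` span the strictly local observables. -/
theorem strictlyLocal_le_span {A : QuasiLocal} (hA : A ∈ strictlyLocalAlgebra Set.univ) :
    A ∈ Submodule.span ℂ (Set.range fun p : Config × Config => X p.1 * Z p.2) := by
  set W := Submodule.span ℂ (Set.range fun p : Config × Config => X p.1 * Z p.2) with hW
  have mem : ∀ a b, X a * Z b ∈ W := fun a b => Submodule.subset_span ⟨(a, b), rfl⟩
  have one : (1 : QuasiLocal) ∈ W := by simpa using mem 0 0
  induction hA using StarAlgebra.adjoin_induction with
  | mem a ha =>
    obtain ⟨v, -, M, rfl⟩ := ha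
    rw [site_eq]
    refine add_mem (add_mem (add_mem ?_ ?_) ?_) ?_ <;> refine W.smul_mem _ ?_
    · exact one
    · simpa using mem (Finsupp.single v 1) 0
    · simpa using mem 0 (Finsupp.single v 1)
    · exact mem _ _
  | algebraMap r => rw [Algebra.algebraMap_eq_smul_one]; exact W.smul_mem _ one
  | add a b _ _ iha ihb => exact add_mem iha ihb
  | mul A B hA hB iha ihb =>
    clear hA hB
    induction iha, ihb using Submodule.span_induction₂ with
    | mem_mem x y hx hy =>
      obtain ⟨⟨a, b⟩, rfl⟩ := hx
      obtain ⟨⟨a', b'⟩, rfl⟩ := hy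
      have : X a * Z b * (X a' * Z b') = sgn (pair a' b) • (X (a + a') * Z (b + b')) := by
        rw [X_add, Z_add, mul_assoc, ← mul_assoc (Z b), Z_mul_X]
        simp only [smul_mul_assoc, mul_smul_comm, mul_assoc]
      simp only [this]
      exact W.smul_mem _ (mem _ _)
    | zero_left y hy => simp
    | zero_right x hx => simp
    | add_left x y z _ _ _ h1 h2 => rw [add_mul]; exact add_mem h1 h2
    | add_right x y z _ _ _ h1 h2 => rw [mul_add]; exact add_mem h1 h2
    | smul_left r x y _ _ h => rw [smul_mul_assoc]; exact W.smul_mem _ h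
    | smul_right r x y _ _ h => rw [mul_smul_comm]; exact W.smul_mem _ h
  | star a ha ih =>
    clear ha
    induction ih using Submodule.span_induction with
    | mem x hx =>
      obtain ⟨⟨a, b⟩, rfl⟩ := hx
      simp only [star_mul, star_X, star_Z, Z_mul_X]
      exact W.smul_mem _ (mem _ _)
    | zero => simp
    | add x y _ _ h1 h2 => rw [star_add]; exact add_mem h1 h2
    | smul r x _ h => rw [star_smul]; exact W.smul_mem _ h

theorem dense_strictlyLocal : Dense (strictlyLocalAlgebra Set.univ : Set QuasiLocal) := by
  intro a
  have : a ∈ localAlgebra Set.univ := by rw [localAlgebra_univ]; trivial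
  exact this

theorem dense_span_XZ : Dense
    (Submodule.span ℂ (Set.range fun p : Config × Config => X p.1 * Z p.2) : Set QuasiLocal) :=
  dense_strictlyLocal.mono fun _ => strictlyLocal_le_span

/-- Positive functionals are automatically continuous, so the dense span of the Pauli products
decides. Equalities of states are checked through this criterion. -/
theorem functional_ext {ω ω' : Functional} (h : ∀ a b, ω (X a * Z b) = ω' (X a * Z b)) :
    ω = ω' := by
  have h1 : (ω : QuasiLocal → ℂ) = ω' := by
    refine Continuous.ext_on dense_span_XZ (map_continuous ω) (map_continuous ω') ?_
    intro A hA
    induction hA using Submodule.span_induction with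
    | mem x hx => obtain ⟨⟨a, b⟩, rfl⟩ := hx; exact h a b
    | zero => simp
    | add x y _ _ h1 h2 => simp [h1, h2]
    | smul r x _ h => simp [h]
  exact DFunLike.coe_injective h1

/-! ### Incidence of faces and edges. -/

/-- The boundary chain of a face. -/
def Face.bd (f : Face) : Config := chain f.boundary

theorem Face.K_eq (f : Face) : f.K = X f.bd := siteProd_sigmaX _
theorem Face.J_eq (f : Face) : f.J = Z f.bd := siteProd_sigmaZ _

theorem Face.ext_coords {f g : Face} (h1 : f.col = g.col) (h2 : f.row = g.row) : f = g := by
  cases f; cases g; simp_all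

theorem Face.mem_boundary (f : Face) (v : Vertex) : v ∈ f.boundary ↔
    (f.col ≤ v.1 ∧ v.1 ≤ f.col + 2) ∧ (f.row ≤ v.2 ∧ v.2 ≤ f.row + 1) := by
  obtain ⟨x, y⟩ := v
  simp only [Face.boundary, List.mem_cons, Prod.mk.injEq, List.not_mem_nil, or_false]
  omega

theorem Face.nodup_boundary (f : Face) : f.boundary.Nodup := by
  simp [Face.boundary]

open scoped Classical in
theorem Face.bd_apply (f : Face) (v : Vertex) : f.bd v = if v ∈ f.boundary then 1 else 0 := by
  rw [Face.bd, chain_apply, List.Nodup.count f.nodup_boundary]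
  split_ifs <;> simp

theorem pair_bd (a : Config) (f : Face) : pair a f.bd =
    a (f.col, f.row) + a (f.col + 1, f.row) + a (f.col + 2, f.row)
      + (a (f.col, f.row + 1) + a (f.col + 1, f.row + 1) + a (f.col + 2, f.row + 1)) := by
  rw [pair_comm, Face.bd, pair_chain]
  simp [Face.boundary]
  abel

/-- Of the three faces at `v`, two contain the whole edge, so the edge leaves only the third. -/
theorem edge_face_unique {v w : Vertex} (e : IsEdge v w) {f g : Face} (hf : v ∈ f.boundary)
    (hf' : w ∉ f.boundary) (hg : v ∈ g.boundary) (hg' : w ∉ g.boundary) : f = g := by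
  have h1 := f.odd
  have h2 := g.odd
  simp only [Face.mem_boundary, IsEdge, Int.odd_iff] at *
  refine Face.ext_coords ?_ ?_ <;> omega

theorem IsEdge.symm {v w : Vertex} (e : IsEdge v w) : IsEdge w v := by
  simp only [IsEdge, Int.odd_iff] at *
  omega

open scoped Classical in
/-- The indicator of a face. -/
def delta (f h : Face) : Fin 2 := if h = f then 1 else 0

@[simp] theorem delta_self (f : Face) : delta f f = 1 := by simp [delta]

theorem delta_of_ne {f h : Face} (e : h ≠ f) : delta f h = 0 := by simp [delta, e]

open scoped Classical in
/-- The two ends of an edge violate exactly the stabilizers of the faces it connects. -/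
theorem Connects.bd_add {v w : Vertex} {f g : Face} (h : Connects v w f g) (k : Face) :
    k.bd v + k.bd w = delta f k + delta g k := by
  obtain ⟨e, h1, h2, h3, h4⟩ := h
  by_cases hf : k = f
  · have hg : f ≠ g := fun hg => h3 (hg ▸ h1)
    subst hf
    simp [Face.bd_apply, h1, h4, delta_of_ne hg]
  by_cases hg : k = g
  · subst hg
    simp [Face.bd_apply, h2, h3, delta_of_ne hf]
  have hv : v ∈ k.boundary ↔ w ∈ k.boundary := by
    constructor
    · intro hv
      by_contra hw
      exact hf (edge_face_unique e hv hw h1 h4)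
    · intro hw
      by_contra hv
      exact hg (edge_face_unique e.symm hw hv h2 h3)
  simp only [Face.bd_apply, hv, fin_two_add_self, delta_of_ne hf, delta_of_ne hg]

/-! ### Face boundaries are exactly the chains that meet all faces evenly. -/

/-- The chains generated by the boundaries of faces. -/
def faceSpan : AddSubgroup Config := AddSubgroup.closure (Set.range Face.bd)

theorem bd_mem (f : Face) : f.bd ∈ faceSpan := AddSubgroup.subset_closure ⟨f, rfl⟩

theorem hom_eq_of_bd {φ ψ : Config →+ Fin 2} (h : ∀ f : Face, φ f.bd = ψ f.bd) {a : Config}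
    (ha : a ∈ faceSpan) : φ a = ψ a :=
  AddMonoidHom.eqOn_closure (s := Set.range Face.bd) (by rintro _ ⟨f, rfl⟩; exact h f) ha

/-- A face has six vertices, two adjacent faces share the two ends of an edge, and all other pairs
of faces are disjoint; every overlap is even. -/
theorem pair_bd_bd (f g : Face) : pair f.bd g.bd = 0 := by
  rw [pair_bd]
  have h1 := f.odd
  have h2 := g.odd
  simp only [Face.bd_apply, Face.mem_boundary, Int.odd_iff] at *
  by_cases hr : f.row = g.row
  · by_cases hc : f.col = g.col
    · simp [hr, hc]
    · by_cases hc' : f.col = g.col + 2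
      · simp [hr, hc']
      · by_cases hc'' : g.col = f.col + 2
        · simp [hr, hc'']
        · repeat rw [if_neg (by omega)]
          simp
  · by_cases hr' : f.row = g.row + 1
    · by_cases hc : f.col = g.col + 1
      · simp [hr', hc]
      · by_cases hc' : g.col = f.col + 1
        · simp [hr', hc', add_assoc]
        · repeat rw [if_neg (by omega)]
          simp
    · by_cases hr'' : g.row = f.row + 1
      · by_cases hc : f.col = g.col + 1
        · simp [hr'', hc]
        · by_cases hc' : g.col = f.col + 1
          · simp [hr'', hc', add_assoc]
          · repeat rw [if_neg (by omega)]
            simp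
      · repeat rw [if_neg (by omega)]
        simp

/-- The leftmost vertex of a nonzero chain in one row is, according to parity, the upper right or
lower right corner of a face that meets the chain nowhere else. -/
theorem cycle_eq_zero_of_row {a : Config} (ha : ∀ f : Face, pair a f.bd = 0) (y : ℤ)
    (hy : ∀ v, a v ≠ 0 → v.2 = y) : a = 0 := by
  by_contra h0
  obtain ⟨v, hv, hmin⟩ := Finset.exists_min_image a.support (fun v => v.1)
    (Finsupp.support_nonempty_iff.2 h0)
  have hv' := Finsupp.mem_support_iff.1 hv
  have e := hy v hv'
  have hleft : ∀ w : Vertex, w.1 < v.1 → a w = 0 := fun w hw => by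
    by_contra h
    have := hmin w (Finsupp.mem_support_iff.2 h)
    omega
  have hrow : ∀ w : Vertex, w.2 ≠ y → a w = 0 := fun w hw => by
    by_contra h
    exact hw (hy w h)
  refine hv' ?_
  have hvv : v = (v.1 - 2 + 2, y) := by ext <;> simp [e]
  rcases Int.even_or_odd (v.1 - 2 + y) with hp | hp
  · have := ha ⟨v.1 - 2, y - 1, by rw [← add_sub_assoc]; exact hp.sub_odd odd_one⟩
    rw [pair_bd] at this
    dsimp only at this
    rw [hrow (v.1 - 2, y - 1) (by simp), hrow (v.1 - 2 + 1, y - 1) (by simp),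
      hrow (v.1 - 2 + 2, y - 1) (by simp), hleft (v.1 - 2, _) (by simp),
      hleft (v.1 - 2 + 1, _) (by dsimp only; omega), sub_add_cancel y 1, ← hvv] at this
    simpa using this
  · have := ha ⟨v.1 - 2, y, hp⟩
    rw [pair_bd] at this
    dsimp only at this
    rw [hrow (v.1 - 2, y + 1) (by simp), hrow (v.1 - 2 + 1, y + 1) (by simp),
      hrow (v.1 - 2 + 2, y + 1) (by simp), hleft (v.1 - 2, _) (by simp),
      hleft (v.1 - 2 + 1, _) (by dsimp only; omega), ← hvv] at this
    simpa using this

/-- The face below a vertex in the middle of its upper side. -/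
def faceBelow (v : Vertex) (h : Odd (v.1 + v.2)) : Face :=
  ⟨v.1 - 1, v.2 - 1, by
    have : v.1 - 1 + (v.2 - 1) = v.1 + v.2 - 2 := by ring
    rw [this]; exact h.sub_even even_two⟩

open scoped Classical in
/-- The sum of the faces below the odd vertices of a chain in the row `y`. -/
def sweep (y : ℤ) : Config →+ Config :=
  Finsupp.liftAddHom fun v => if h : v.2 = y ∧ Odd (v.1 + v.2) then
    { toFun := fun x => x • (faceBelow v h.2).bd
      map_zero' := by ext w; simp
      map_add' := fun x y => by ext w : 1; simp [add_mul] }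
    else 0

theorem sweep_mem (y : ℤ) (a : Config) : sweep y a ∈ faceSpan := by
  induction a using Finsupp.induction_linear with
  | zero => simp
  | add f g hf hg => rw [map_add]; exact add_mem hf hg
  | single v x =>
    rw [sweep, Finsupp.liftAddHom_apply_single]
    split_ifs with h
    · rcases fin_two_cases x with rfl | rfl
      · simp
      · change (1 : Fin 2) • _ ∈ faceSpan
        rw [one_smul]
        exact bd_mem _
    · simp

theorem sweep_apply_of_ne (y : ℤ) (a : Config) (w : Vertex) (h1 : w.2 ≠ y) (h2 : w.2 ≠ y - 1) :
    sweep y a w = 0 := by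
  induction a using Finsupp.induction_linear with
  | zero => simp
  | add f g hf hg => rw [map_add, Finsupp.add_apply, hf, hg, add_zero]
  | single v x =>
    rw [sweep, Finsupp.liftAddHom_apply_single]
    split_ifs with h
    · change x • ((faceBelow v h.2).bd w) = 0
      rw [Face.bd_apply, if_neg, smul_zero]
      rw [Face.mem_boundary]
      simp only [faceBelow]
      omega
    · simp

/-- The upper side of a face just below the row `y` has an odd vertex in the middle and even
vertices at its ends. An odd vertex of the row thus meets one such face, an even vertex
(`sweep_apply_even`) two neighboring ones. -/
theorem sweep_apply_odd (y : ℤ) (a : Config) (x : ℤ) (hx : Odd (x + y)) :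
    sweep y a (x, y) = a (x, y) := by
  induction a using Finsupp.induction_linear with
  | zero => simp
  | add f g hf hg => rw [map_add, Finsupp.add_apply, hf, hg, Finsupp.add_apply]
  | single v j =>
    rw [sweep, Finsupp.liftAddHom_apply_single, Finsupp.single_apply]
    obtain ⟨v1, v2⟩ := v
    rw [Int.odd_iff] at hx
    split_ifs with h h' h'
    · change j • ((faceBelow _ h.2).bd (x, y)) = j
      rw [Face.bd_apply, if_pos, smul_eq_mul, mul_one]
      rw [Face.mem_boundary]
      simp only [faceBelow, Prod.mk.injEq] at *
      omega
    · change j • ((faceBelow _ h.2).bd (x, y)) = 0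
      have h2 := h.2
      rw [Face.bd_apply, if_neg, smul_zero]
      rw [Face.mem_boundary]
      simp only [faceBelow, Prod.mk.injEq, Int.odd_iff] at *
      omega
    · simp only [Prod.mk.injEq, Int.odd_iff] at *
      omega
    · simp

theorem sweep_apply_even (y : ℤ) (a : Config) (x : ℤ) (hx : Odd (x + y)) :
    sweep y a (x + 1, y) = a (x, y) + a (x + 2, y) := by
  induction a using Finsupp.induction_linear with
  | zero => simp
  | add f g hf hg => rw [map_add, Finsupp.add_apply, hf, hg]; simp only [Finsupp.add_apply]; abel
  | single v j =>
    rw [sweep, Finsupp.liftAddHom_apply_single, Finsupp.single_apply, Finsupp.single_apply]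
    obtain ⟨v1, v2⟩ := v
    rw [Int.odd_iff] at hx
    by_cases h : v2 = y ∧ Odd (v1 + v2)
    · have h2 := h.2
      rw [dif_pos h]
      change j • ((faceBelow _ h.2).bd (x + 1, y)) = _
      simp only [Face.bd_apply, Face.mem_boundary, faceBelow, Prod.mk.injEq, Int.odd_iff] at *
      by_cases h3 : v1 = x
      · rw [if_pos (by omega), if_pos (by omega), if_neg (by omega)]; simp
      · by_cases h4 : v1 = x + 2
        · rw [if_pos (by omega), if_neg (by omega), if_pos (by omega)]; simp
        · rw [if_neg (by omega), if_neg (by omega), if_neg (by omega)]; simp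
    · rw [dif_neg h]
      simp only [Prod.mk.injEq, Int.odd_iff] at *
      rw [if_neg (by omega), if_neg (by omega)]; simp

theorem pair_eq_zero_of_mem {a : Config} (ha : a ∈ faceSpan) (f : Face) : pair a f.bd = 0 := by
  rw [pair_comm]
  exact hom_eq_of_bd (φ := pair f.bd) (ψ := 0) (fun g => pair_bd_bd f g) ha

/-- Adding `sweep t a` clears the top row `t`. Odd vertices cancel directly. At an even vertex the
new value is the sum of `a` over three consecutive vertices, the lower side of a face above; the
upper side of that face is outside the support, so evenness makes the sum vanish. Besides row `t`
only row `t - 1` changes, so the number of rows drops. -/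
theorem cycle_mem_of_rows (n : ℕ) : ∀ (a : Config) (y : ℤ), (∀ f : Face, pair a f.bd = 0) →
    (∀ v, a v ≠ 0 → y ≤ v.2 ∧ v.2 ≤ y + n) → a ∈ faceSpan := by
  induction n with
  | zero =>
    intro a y ha hy
    rw [cycle_eq_zero_of_row ha y fun v hv => by have := hy v hv; push_cast at this; omega]
    exact zero_mem _
  | succ n ih =>
    intro a y ha hy
    set t : ℤ := y + n + 1 with ht
    have hup : ∀ w : Vertex, t < w.2 → a w = 0 := fun w hw => by
      by_contra h
      have := hy w h
      push_cast at this
      omega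
    have key : a + sweep t a ∈ faceSpan := by
      refine ih _ y (fun f => ?_) fun w hw => ?_
      · rw [pair_add_left, ha, pair_eq_zero_of_mem (sweep_mem t a), add_zero]
      · rw [Finsupp.add_apply] at hw
        by_cases h1 : w.2 = t
        · exfalso
          apply hw
          obtain ⟨x, z⟩ := w
          replace h1 : z = t := h1
          rw [h1]
          clear h1 hw
          rcases Int.even_or_odd (x + t) with hp | hp
          · have hp' : Odd (x - 1 + t) := by
              rw [sub_add_eq_add_sub]; exact hp.sub_odd odd_one
            have h2 := sweep_apply_even t a (x - 1) hp'
            have h3 := ha ⟨x - 1, t, hp'⟩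
            rw [pair_bd] at h3
            dsimp only at h3
            rw [hup (x - 1, t + 1) (by simp), hup (x - 1 + 1, t + 1) (by simp),
              hup (x - 1 + 2, t + 1) (by simp)] at h3
            rw [sub_add_cancel] at h2 h3
            rw [h2]
            linear_combination h3
          · rw [sweep_apply_odd t a x hp, fin_two_add_self]
        · by_cases h2 : w.2 = t - 1
          · push_cast at *; omega
          · rw [sweep_apply_of_ne t a w h1 h2, add_zero] at hw
            have := hy w hw
            push_cast at this
            omega
    have := sub_mem key (sweep_mem t a)
    rwa [add_sub_cancel_right] at this

/-- Every finite chain that meets all faces evenly is a sum of face boundaries. -/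
theorem mem_faceSpan_iff {a : Config} : a ∈ faceSpan ↔ ∀ f : Face, pair a f.bd = 0 := by
  refine ⟨pair_eq_zero_of_mem, fun ha => ?_⟩
  obtain ⟨B, hB⟩ : ∃ B : ℕ, ∀ v, a v ≠ 0 → v.2.natAbs ≤ B :=
    ⟨a.support.sup fun v => v.2.natAbs, fun v hv =>
      Finset.le_sup (f := fun v : Vertex => v.2.natAbs) (Finsupp.mem_support_iff.2 hv)⟩
  refine cycle_mem_of_rows (2 * B) a (-B) ha fun v hv => ?_
  have := hB v hv
  push_cast
  omega

/-! ### Strings between faces of the same color. -/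

/-- Two faces are joined if some finite set of vertices violates exactly their stabilizers. -/
def Joined (f g : Face) : Prop :=
  ∃ l : List Vertex, ∀ h : Face, pair (chain l) h.bd = delta f h + delta g h

theorem Joined.refl (f : Face) : Joined f f := ⟨[], fun h => by simp [fin_two_add_self]⟩

theorem Joined.symm {f g : Face} (h : Joined f g) : Joined g f := by
  obtain ⟨l, hl⟩ := h
  exact ⟨l, fun k => by rw [hl, add_comm]⟩

theorem Joined.trans {f g h : Face} (h1 : Joined f g) (h2 : Joined g h) : Joined f h := by
  obtain ⟨l, hl⟩ := h1
  obtain ⟨m, hm⟩ := h2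
  refine ⟨l ++ m, fun k => ?_⟩
  rw [chain_append, pair_add_left, hl, hm]
  linear_combination fin_two_add_self (delta g k)

theorem Connects.joined {v w : Vertex} {f g : Face} (h : Connects v w f g) : Joined f g :=
  ⟨[v, w], fun k => by rw [pair_chain]; simpa using h.bd_add k⟩

/-- The moves `(0, 2)` and `(3, 1)` of the face corner generate all displacements between faces of
equal color: these have the form `(3m, r)` with `r - m` even. -/
theorem connects_up {f g : Face} (h1 : g.col = f.col) (h2 : g.row = f.row + 2) :
    Connects (f.col + 1, f.row + 1) (f.col + 1, f.row + 2) f g := by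
  have h := Int.odd_iff.1 f.odd
  constructor <;> simp only [Face.mem_boundary, IsEdge, Int.odd_iff, true_and] <;> omega

theorem connects_right {f g : Face} (h1 : g.col = f.col + 3) (h2 : g.row = f.row + 1) :
    Connects (f.col + 2, f.row + 1) (f.col + 3, f.row + 1) f g := by
  have h := Int.odd_iff.1 f.odd
  constructor <;> simp only [Face.mem_boundary, IsEdge, Int.odd_iff, true_and] <;> omega

theorem joined_up (n : ℕ) : ∀ f g : Face, g.col = f.col → g.row = f.row + 2 * n → Joined f g := by
  induction n with
  | zero =>
    intro f g h1 h2
    rw [Face.ext_coords h1 (h2.trans (by simp))]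
    exact .refl f
  | succ n ih =>
    intro f g h1 h2
    push_cast at h2
    have ho := g.odd
    have he : Odd (f.col + (f.row + 2 * n)) := by rw [Int.odd_iff] at *; omega
    exact (ih f ⟨f.col, f.row + 2 * n, he⟩ rfl rfl).trans
      (connects_up (f := ⟨f.col, f.row + 2 * n, he⟩) h1 (by dsimp only; omega)).joined

theorem joined_right (n : ℕ) :
    ∀ f g : Face, g.col = f.col + 3 * n → g.row = f.row + n → Joined f g := by
  induction n with
  | zero =>
    intro f g h1 h2
    rw [Face.ext_coords (f := g) (g := f) (h1.trans (by simp)) (h2.trans (by simp))]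
    exact .refl f
  | succ n ih =>
    intro f g h1 h2
    push_cast at h1 h2
    have ho := g.odd
    have he : Odd (f.col + 3 * n + (f.row + n)) := by rw [Int.odd_iff] at *; omega
    exact (ih f ⟨f.col + 3 * n, f.row + n, he⟩ rfl rfl).trans
      (connects_right (by dsimp only; omega) (by dsimp only; omega)).joined

theorem color_eq_iff {f g : Face} : f.color = g.color ↔ f.col % 3 = g.col % 3 := by
  unfold Face.color
  constructor
  · intro h
    split_ifs at h <;> omega
  · intro h
    rw [h]

/-- All faces of the same color are joined. -/
theorem joined_of_color_eq {f g : Face} (h : f.color = g.color) : Joined f g := by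
  rw [color_eq_iff] at h
  have hf := f.odd
  have hg := g.odd
  obtain ⟨m, hm⟩ : ∃ m, g.col = f.col + 3 * m := ⟨(g.col - f.col) / 3, by omega⟩
  have he : Odd (g.col + (f.row + m)) := by rw [Int.odd_iff] at *; omega
  set e : Face := ⟨g.col, f.row + m, he⟩
  have h1 : Joined f e := by
    rcases Int.eq_nat_or_neg m with ⟨n, rfl | rfl⟩
    · exact joined_right n f e hm rfl
    · exact (joined_right n e f (by dsimp only [e]; omega) (by dsimp only [e]; omega)).symm
  refine h1.trans ?_
  obtain ⟨j, hj⟩ : ∃ j, g.row = f.row + m + 2 * j :=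
    ⟨(g.row - f.row - m) / 2, by rw [Int.odd_iff] at *; omega⟩
  rcases Int.eq_nat_or_neg j with ⟨n, rfl | rfl⟩
  · exact joined_up n e g rfl hj
  · exact (joined_up n g e rfl (by dsimp only [e]; omega)).symm

theorem exists_string (f : Face) : ∃ γ : HalfInfiniteString f.color, γ.face 0 = f := by
  have ho := f.odd
  refine ⟨{ face := fun i => ⟨f.col, f.row + 2 * i, ?_⟩
            vtx := fun j => (f.col + 1, f.row + j + 1)
            color_face := fun i => color_eq_iff.2 rfl
            connects := fun i => ?_
            finite_visits := fun v => ?_ }, ?_⟩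
  · rw [Int.odd_iff] at *; omega
  · have := connects_up (f := ⟨f.col, f.row + 2 * i, by rw [Int.odd_iff] at *; omega⟩)
      (g := ⟨f.col, f.row + 2 * ((i + 1 : ℕ) : ℤ), by rw [Int.odd_iff] at *; omega⟩) rfl
      (by push_cast; ring)
    convert this using 2
    · push_cast; ring
    · push_cast; ring
  · refine Set.Subsingleton.finite fun m hm n hn => ?_
    have := (congrArg Prod.snd hm).trans (congrArg Prod.snd hn).symm
    simpa using this
  · exact Face.ext_coords rfl (by simp)

/-! ### Coverings by faces of each color. -/

/-- Each vertex belongs to exactly one face of each color. -/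
theorem existsUnique_face (v : Vertex) (c : Color) :
    ∃! f : Face, f.color = c ∧ v ∈ f.boundary := by
  obtain ⟨f₀, hf₀⟩ : ∃ f₀ : Face, f₀.color = c := by
    cases c
    · exact ⟨⟨0, 1, by decide⟩, rfl⟩
    · exact ⟨⟨1, 0, by decide⟩, rfl⟩
    · exact ⟨⟨2, 1, by decide⟩, rfl⟩
  subst hf₀
  simp only [color_eq_iff, Face.mem_boundary]
  obtain ⟨a, ha, h1⟩ : ∃ a : ℤ, a % 3 = f₀.col % 3 ∧ a ≤ v.1 ∧ v.1 ≤ a + 2 :=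
    ⟨v.1 - (v.1 - f₀.col) % 3, by omega, by omega, by omega⟩
  obtain ⟨b, hb, h2⟩ : ∃ b : ℤ, Odd (a + b) ∧ b ≤ v.2 ∧ v.2 ≤ b + 1 := by
    rcases Int.even_or_odd (a + v.2) with h | h
    · exact ⟨v.2 - 1, by rw [← add_sub_assoc]; exact h.sub_odd odd_one, by omega, by omega⟩
    · exact ⟨v.2, h, by omega, by omega⟩
  refine ⟨⟨a, b, hb⟩, ⟨ha, h1, h2⟩, fun g ⟨hg1, hg2, hg3⟩ => ?_⟩
  have := g.odd
  rw [Int.odd_iff] at *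
  refine Face.ext_coords ?_ ?_ <;> dsimp only <;> omega

open scoped Classical in
/-- The boundary of the union of the faces of color `c` in a finite set of faces. -/
def colorSum (D : Finset Face) (c : Color) : Config := ∑ f ∈ D with f.color = c, f.bd

theorem colorSum_mem (D : Finset Face) (c : Color) : colorSum D c ∈ faceSpan :=
  sum_mem fun f _ => bd_mem f

open scoped Classical in
theorem hom_colorSum {φ : Config →+ Fin 2} {f : Face} (hφ : ∀ h : Face, φ h.bd = delta f h)
    {D : Finset Face} (hf : f ∈ D) (c : Color) :
    φ (colorSum D c) = if f.color = c then 1 else 0 := by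
  rw [colorSum, map_sum]
  simp only [hφ, delta, Finset.sum_ite_eq', Finset.mem_filter, hf, true_and]

/-- Given finitely many vertices and two faces, there are finitely many faces, the two given ones
among them, whose union covers the vertices exactly once in each color. -/
theorem exists_covering (F : Finset Vertex) (f g : Face) :
    ∃ D : Finset Face, f ∈ D ∧ g ∈ D ∧ ∀ v ∈ F, ∀ c, colorSum D c v = 1 := by
  classical
  choose φ hφ hu using existsUnique_face
  -- All three faces at each vertex of `F` are taken. Surplus faces do no harm: by uniqueness, no
  -- other face of color `c` contains the vertex.
  refine ⟨insert f (insert g (F.biUnion fun v => {φ v .r, φ v .g, φ v .b})), by simp, by simp,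
    fun v hv c => ?_⟩
  rw [colorSum, Finsupp.finsetSum_apply, Finset.sum_eq_single (φ v c)]
  · rw [Face.bd_apply, if_pos (hφ v c).2]
  · intro h hh hne
    rw [Face.bd_apply, if_neg]
    intro hmem
    exact hne (hu v c h ⟨(Finset.mem_filter.1 hh).2, hmem⟩)
  · intro h
    refine (h (Finset.mem_filter.2 ⟨?_, (hφ v c).1⟩)).elim
    refine Finset.mem_insert_of_mem (Finset.mem_insert_of_mem
      (Finset.mem_biUnion.2 ⟨v, hv, ?_⟩))
    cases c <;> simp

/-! ### Translations of the colored lattice. -/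

/-- The translate of a face by `6 u`. -/
def Face.shift (f : Face) (u : ℤ × ℤ) : Face :=
  ⟨f.col + 6 * u.1, f.row + 6 * u.2, by
    have := f.odd
    rw [Int.odd_iff] at *
    omega⟩

/-- The translate of a vertex by `6 u`. -/
def shiftVertex (u : ℤ × ℤ) (v : Vertex) : Vertex := (v.1 + 6 * u.1, v.2 + 6 * u.2)

/-- The factor 6 is divisible by 2 and by 3, so the translations respect both the parity condition
on faces and the coloring. -/
theorem Face.shift_color (f : Face) (u : ℤ × ℤ) : (f.shift u).color = f.color := by
  rw [color_eq_iff]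
  simp only [Face.shift]
  omega

theorem Face.shift_shift (f : Face) (u w : ℤ × ℤ) : (f.shift u).shift w = f.shift (u + w) := by
  refine Face.ext_coords ?_ ?_ <;> simp only [Face.shift, Prod.fst_add, Prod.snd_add] <;> ring

theorem Face.shift_zero (f : Face) : f.shift 0 = f := by
  refine Face.ext_coords ?_ ?_ <;> simp [Face.shift]

theorem bd_shiftVertex (h : Face) (u : ℤ × ℤ) (v : Vertex) :
    h.bd (shiftVertex u v) = (h.shift (-u)).bd v := by
  classical
  simp only [Face.bd_apply, Face.mem_boundary, shiftVertex, Face.shift, Prod.fst_neg, Prod.snd_neg]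
  congr 1
  refine propext ?_
  omega

theorem delta_shift (f h : Face) (u : ℤ × ℤ) : delta f (h.shift (-u)) = delta (f.shift u) h := by
  have : h.shift (-u) = f ↔ h = f.shift u := by
    constructor
    · rintro rfl
      rw [Face.shift_shift, neg_add_cancel, Face.shift_zero]
    · rintro rfl
      rw [Face.shift_shift, add_neg_cancel, Face.shift_zero]
  classical
  unfold delta
  exact if_congr this rfl rfl

theorem pair_shift (l : List Vertex) (u : ℤ × ℤ) (h : Face) :
    pair (chain (l.map (shiftVertex u))) h.bd = pair (chain l) (h.shift (-u)).bd := by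
  rw [pair_chain, pair_chain, List.map_map]
  congr 1
  exact List.map_congr_left fun v _ => bd_shiftVertex h u v

/-! ### Cyclic representations and the GNS construction. -/

section Representations

variable {H₁ H₂ H₃ : Type*} [NormedAddCommGroup H₁] [InnerProductSpace ℂ H₁] [CompleteSpace H₁]
  [NormedAddCommGroup H₂] [InnerProductSpace ℂ H₂] [CompleteSpace H₂]
  [NormedAddCommGroup H₃] [InnerProductSpace ℂ H₃] [CompleteSpace H₃]

theorem inner_rep (π : Rep H₁) (a b : QuasiLocal) (ξ η : H₁) :
    ⟪π a ξ, π b η⟫_ℂ = ⟪ξ, π (star a * b) η⟫_ℂ := by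
  rw [map_mul, map_star, mul_apply_eq_comp, ContinuousLinearMap.star_eq_adjoint,
    ContinuousLinearMap.adjoint_inner_right]

theorem continuous_rep (π : Rep H₁) : Continuous π :=
  AddMonoidHomClass.continuous_of_bound π 1 fun a => by
    rw [one_mul]; exact NonUnitalStarAlgHom.norm_apply_le π a

/-- The orbit map of a vector. -/
def orbitMap (π : Rep H₁) (ξ : H₁) : QuasiLocal →ₗ[ℂ] H₁ where
  toFun a := π a ξ
  map_add' a b := by simp
  map_smul' r a := by simp

/-- Cyclic representations with the same vector state are unitarily equivalent. -/
theorem equivalent_of_cyclic {π₁ : Rep H₁} {π₂ : Rep H₂} {ξ₁ : H₁} {ξ₂ : H₂}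
    (h₁ : DenseRange fun a => π₁ a ξ₁) (h₂ : DenseRange fun a => π₂ a ξ₂)
    (h : ∀ a, ⟪ξ₁, π₁ a ξ₁⟫_ℂ = ⟪ξ₂, π₂ a ξ₂⟫_ℂ) : Equivalent π₁ π₂ := by
  have hn : ∀ a, ‖orbitMap π₂ ξ₂ (LinearEquiv.refl ℂ QuasiLocal a)‖ = ‖orbitMap π₁ ξ₁ a‖ := by
    intro a
    change ‖π₂ a ξ₂‖ = ‖π₁ a ξ₁‖
    rw [@norm_eq_sqrt_re_inner ℂ, @norm_eq_sqrt_re_inner ℂ, inner_rep, inner_rep, h]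
  let U := (LinearEquiv.refl ℂ QuasiLocal).extendOfIsometry (orbitMap π₁ ξ₁) (orbitMap π₂ ξ₂)
    h₁ h₂ hn
  have hU : ∀ a, U (π₁ a ξ₁) = π₂ a ξ₂ := fun a =>
    LinearEquiv.extendOfIsometry_eq (LinearEquiv.refl ℂ QuasiLocal) (orbitMap π₁ ξ₁)
      (orbitMap π₂ ξ₂) h₁ h₂ hn a
  refine ⟨U, fun a x => ?_⟩
  refine h₁.induction_on (p := fun x => U (π₁ a x) = π₂ a (U x)) x ?_ fun b => ?_
  · exact isClosed_eq (by fun_prop) (by fun_prop)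
  · rw [hU, ← mul_apply_eq_comp, ← map_mul, hU, map_mul, mul_apply_eq_comp]

theorem Equivalent.trans {π₁ : Rep H₁} {π₂ : Rep H₂} {π₃ : Rep H₃} (h : Equivalent π₁ π₂)
    (h' : Equivalent π₂ π₃) : Equivalent π₁ π₃ := by
  obtain ⟨U, hU⟩ := h
  obtain ⟨V, hV⟩ := h'
  exact ⟨U.trans V, fun a x => by simp [hU, hV]⟩

/-- A unitary with expectation value one fixes the vector. -/
theorem rep_fix {π : Rep H₁} {ξ : H₁} (hξ : ‖ξ‖ = 1) {S : QuasiLocal} (hS : S ∈ unitary QuasiLocal)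
    (h : ⟪ξ, π S ξ⟫_ℂ = 1) : π S ξ = ξ := by
  have hn : ‖π S ξ‖ = 1 := by
    rw [← hξ, @norm_eq_sqrt_re_inner ℂ _ _ _ _ (π S ξ), inner_rep, hS.1, map_one,
      @norm_eq_sqrt_re_inner ℂ]
    rfl
  exact ((inner_eq_one_iff_of_norm_eq_one hξ hn).1 h).symm

end Representations

/-- The cyclic vector of the GNS representation. -/
def cyclicVector (ω : Functional) : ω.GNS := ((ω.toPreGNS 1 : ω.PreGNS) : ω.GNS)

theorem gns_cyclicVector (ω : Functional) (a : QuasiLocal) :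
    gns ω a (cyclicVector ω) = ((ω.toPreGNS a : ω.PreGNS) : ω.GNS) := by
  change ω.gnsNonUnitalStarAlgHom a (cyclicVector ω) = _
  rw [cyclicVector, PositiveLinearMap.gnsNonUnitalStarAlgHom_apply_coe]
  exact congrArg (fun x => ((ω.toPreGNS x : ω.PreGNS) : ω.GNS)) (mul_one a)

theorem inner_cyclicVector (ω : Functional) (a : QuasiLocal) :
    ⟪cyclicVector ω, gns ω a (cyclicVector ω)⟫_ℂ = ω a := by
  rw [gns_cyclicVector, cyclicVector, UniformSpace.Completion.inner_coe,
    PositiveLinearMap.preGNS_inner_def]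
  simp

theorem dense_cyclicVector (ω : Functional) :
    DenseRange fun a => gns ω a (cyclicVector ω) := by
  have h : (fun a => gns ω a (cyclicVector ω))
      = (fun x : ω.PreGNS => (x : ω.GNS)) ∘ ω.toPreGNS := by
    funext a
    exact gns_cyclicVector ω a
  rw [h]
  exact UniformSpace.Completion.denseRange_coe.comp ω.toPreGNS.surjective.denseRange
    (UniformSpace.Completion.continuous_coe _)

theorem norm_cyclicVector {ω : Functional} (h : ω 1 = 1) : ‖cyclicVector ω‖ = 1 := by
  have := inner_cyclicVector ω 1
  rw [map_one, h] at this
  rw [@norm_eq_sqrt_re_inner ℂ, show ⟪cyclicVector ω, cyclicVector ω⟫_ℂ = 1 from this]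
  simp

theorem equivalent_gns_of_cyclic {ω : Functional} {H : Type*} [NormedAddCommGroup H]
    [InnerProductSpace ℂ H] [CompleteSpace H] {π : Rep H} {ξ : H}
    (hd : DenseRange fun a => π a ξ) (h : ∀ a, ⟪ξ, π a ξ⟫_ℂ = ω a) : Equivalent (gns ω) π :=
  equivalent_of_cyclic (dense_cyclicVector ω) hd fun a => by rw [inner_cyclicVector, h]

/-- Conjugating a state by a unitary observable does not change the GNS representation. -/
theorem equivalent_of_conj {ω ω' : Functional} {S : QuasiLocal} (hS : S ∈ unitary QuasiLocal)
    (h : ∀ a, ω' a = ω (star S * a * S)) : Equivalent (gns ω') (gns ω) := by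
  -- The vector `gns ω S (cyclicVector ω)` induces `ω'`, and it is cyclic because right
  -- multiplication by a unitary is onto.
  refine equivalent_gns_of_cyclic (ξ := gns ω S (cyclicVector ω)) ?_ fun a => ?_
  · have : (fun a => gns ω a (gns ω S (cyclicVector ω)))
        = (fun a => gns ω a (cyclicVector ω)) ∘ fun a => a * S := by
      funext a
      simp only [Function.comp, map_mul, mul_apply_eq_comp]
    rw [this]
    have hs : Function.Surjective fun a : QuasiLocal => a * S := fun b =>
      ⟨b * star S, by simp only [mul_assoc, hS.1, mul_one]⟩
    refine (dense_cyclicVector ω).comp hs.denseRange ?_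
    have := continuous_rep (gns ω)
    fun_prop
  · rw [← mul_apply_eq_comp, ← map_mul, inner_rep, inner_cyclicVector, h, mul_assoc]

/-! ### Vacuum expectation values and uniqueness. -/

theorem X_unitary (a : Config) : X a ∈ unitary QuasiLocal := siteProd_unitary sigmaX_sq _
theorem Z_unitary (a : Config) : Z a ∈ unitary QuasiLocal := siteProd_unitary sigmaZ_sq _

theorem vacuum_X_fix {ω : Functional} (hω : IsVacuum ω) {a : Config} (ha : a ∈ faceSpan) :
    gns ω (X a) (cyclicVector ω) = cyclicVector ω := by
  induction ha using AddSubgroup.closure_induction with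
  | mem x hx =>
    obtain ⟨f, rfl⟩ := hx
    refine rep_fix (norm_cyclicVector hω.1) (X_unitary _) ?_
    rw [inner_cyclicVector, ← Face.K_eq, (hω.2 f).1]
  | zero => simp
  | add x y _ _ hx hy => rw [X_add, map_mul, mul_apply_eq_comp, hy, hx]
  | neg x _ hx => rwa [neg_eq_of_add_eq_zero_left (config_add_self x)]

theorem vacuum_Z_fix {ω : Functional} (hω : IsVacuum ω) {a : Config} (ha : a ∈ faceSpan) :
    gns ω (Z a) (cyclicVector ω) = cyclicVector ω := by
  induction ha using AddSubgroup.closure_induction with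
  | mem x hx =>
    obtain ⟨f, rfl⟩ := hx
    refine rep_fix (norm_cyclicVector hω.1) (Z_unitary _) ?_
    rw [inner_cyclicVector, ← Face.J_eq, (hω.2 f).2]
  | zero => simp
  | add x y _ _ hx hy => rw [Z_add, map_mul, mul_apply_eq_comp, hy, hx]
  | neg x _ hx => rwa [neg_eq_of_add_eq_zero_left (config_add_self x)]

theorem functional_conj {ω : Functional} {S : QuasiLocal}
    (hS : gns ω S (cyclicVector ω) = cyclicVector ω) (A : QuasiLocal) : ω (star S * A * S) = ω A := by
  rw [mul_assoc, ← inner_cyclicVector, ← inner_rep, map_mul, mul_apply_eq_comp, hS,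
    inner_cyclicVector]

theorem vacuum_one {ω : Functional} (hω : IsVacuum ω) {a b : Config} (ha : a ∈ faceSpan)
    (hb : b ∈ faceSpan) : ω (X a * Z b) = 1 := by
  rw [← inner_cyclicVector, map_mul, mul_apply_eq_comp, vacuum_Z_fix hω hb, vacuum_X_fix hω ha]
  simpa [hω.1] using inner_cyclicVector ω 1

/-- A chain outside `faceSpan` meets some face oddly. The `J_f` (for `a`) or `K_f` (for `b`) of that
face anticommutes with the product but fixes the vacuum vector, so the value equals its own
negative. -/
theorem vacuum_zero {ω : Functional} (hω : IsVacuum ω) {a b : Config}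
    (h : ¬ (a ∈ faceSpan ∧ b ∈ faceSpan)) :
    ω (X a * Z b) = 0 := by
  have key : ω (X a * Z b) = - ω (X a * Z b) := by
    by_cases ha : a ∈ faceSpan
    · have hb : b ∉ faceSpan := fun hb => h ⟨ha, hb⟩
      rw [mem_faceSpan_iff] at hb
      push Not at hb
      obtain ⟨f, hf⟩ := hb
      have hf' : pair f.bd b = 1 := by
        rw [pair_comm]; exact (fin_two_cases _).resolve_left hf
      have h1 := functional_conj (vacuum_X_fix hω (bd_mem f)) (X a * Z b)
      rw [star_X, mul_assoc, mul_assoc, Z_mul_X, hf', ← mul_assoc, ← X_add, add_comm, X_add,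
        mul_smul_comm, ← mul_assoc, mul_assoc (X a), X_mul_self, mul_one] at h1
      simpa using h1.symm
    · rw [mem_faceSpan_iff] at ha
      push Not at ha
      obtain ⟨f, hf⟩ := ha
      have hf' : pair a f.bd = 1 := (fin_two_cases _).resolve_left hf
      have h1 := functional_conj (vacuum_Z_fix hω (bd_mem f)) (X a * Z b)
      rw [star_Z, ← mul_assoc, Z_mul_X, hf', mul_assoc, ← Z_add, add_comm, Z_add,
        smul_mul_assoc, ← mul_assoc, mul_assoc (X a), Z_mul_self, mul_one] at h1
      simpa using h1.symm
  exact CharZero.eq_neg_self_iff.1 key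

theorem vacuum_unique {ω ω' : Functional} (h : IsVacuum ω) (h' : IsVacuum ω') : ω = ω' := by
  refine functional_ext fun a b => ?_
  by_cases hab : a ∈ faceSpan ∧ b ∈ faceSpan
  · rw [vacuum_one h hab.1 hab.2, vacuum_one h' hab.1 hab.2]
  · rw [vacuum_zero h hab, vacuum_zero h' hab]

/-! ### Twists by signs and their states. -/

/-- The part of `X a * Z b` on which a string of type `k` acts by signs. -/
def sel : Pauli → Config → Config → Config
  | .x, _, b => b
  | .y, a, b => a + b
  | .z, a, _ => a

theorem sel_mem (k : Pauli) {a b : Config} (ha : a ∈ faceSpan) (hb : b ∈ faceSpan) :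
    sel k a b ∈ faceSpan := by
  cases k
  · exact hb
  · exact add_mem ha hb
  · exact ha

theorem X_conj (c a b : Config) :
    star (X c) * (X a * Z b) * X c = sgn (pair c b) • (X a * Z b) := by
  rw [star_X, mul_assoc, mul_assoc, Z_mul_X, ← mul_assoc, ← X_add, add_comm, X_add,
    mul_smul_comm, ← mul_assoc, mul_assoc (X a), X_mul_self, mul_one]

theorem Z_conj (c a b : Config) :
    star (Z c) * (X a * Z b) * Z c = sgn (pair c a) • (X a * Z b) := by
  rw [star_Z, ← mul_assoc, Z_mul_X, mul_assoc, ← Z_add, add_comm, Z_add, pair_comm,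
    smul_mul_assoc, ← mul_assoc, mul_assoc (X a), Z_mul_self, mul_one]

theorem stringOp_conj (k : Pauli) (l : List Vertex) (a b : Config) :
    star (stringOp k l) * (X a * Z b) * stringOp k l
      = sgn (pair (chain l) (sel k a b)) • (X a * Z b) := by
  cases k
  · rw [stringOp, siteProd_sigmaX, X_conj, sel]
  · have : star (X (chain l) * Z (chain l)) * (X a * Z b) * (X (chain l) * Z (chain l))
        = star (Z (chain l)) * (star (X (chain l)) * (X a * Z b) * X (chain l)) * Z (chain l) := by
      simp only [star_mul, mul_assoc]
    rw [stringOp, siteProd_sigmaX, siteProd_sigmaZ, this, X_conj, mul_smul_comm, smul_mul_assoc,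
      Z_conj, smul_smul, ← sgn_add, sel, map_add, add_comm]
  · rw [stringOp, siteProd_sigmaZ, Z_conj, sel]

/-- The endomorphism acts on products of Pauli matrices by the signs given by `φ`. -/
def IsTwist (ρ : QuasiLocal →⋆ₐ[ℂ] QuasiLocal) (k : Pauli) (φ : Config →+ Fin 2) : Prop :=
  ∀ a b, ρ (X a * Z b) = sgn (φ (sel k a b)) • (X a * Z b)

/-- Conjugation by a string operator. -/
def stringConj (k : Pauli) (l : List Vertex) : QuasiLocal →⋆ₐ[ℂ] QuasiLocal :=
  (Unitary.conjStarAlgAut ℂ QuasiLocal ⟨_, Unitary.star_mem (stringOp_unitary k l)⟩ :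
    QuasiLocal →⋆ₐ[ℂ] QuasiLocal)

theorem stringConj_apply (k : Pauli) (l : List Vertex) (A : QuasiLocal) :
    stringConj k l A = star (stringOp k l) * A * stringOp k l := by
  change star (stringOp k l) * A * star (star (stringOp k l)) = _
  rw [star_star]

theorem stringConj_isTwist (k : Pauli) (l : List Vertex) :
    IsTwist (stringConj k l) k (pair (chain l)) := fun a b => by
  rw [stringConj_apply, stringOp_conj]

/-- The state `ω ∘ ρ`. -/
def twistState (ω : Functional) (ρ : QuasiLocal →⋆ₐ[ℂ] QuasiLocal) : Functional :=
  ω.comp (PositiveLinearMap.ofClass ρ)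

theorem twistState_apply (ω : Functional) (ρ : QuasiLocal →⋆ₐ[ℂ] QuasiLocal) (a : QuasiLocal) :
    twistState ω ρ a = ω (ρ a) := rfl

theorem IsTwist.apply {ρ : QuasiLocal →⋆ₐ[ℂ] QuasiLocal} {k : Pauli} {φ : Config →+ Fin 2}
    (h : IsTwist ρ k φ) (ω : Functional) (a b : Config) :
    twistState ω ρ (X a * Z b) = sgn (φ (sel k a b)) * ω (X a * Z b) := by
  rw [twistState_apply, h, map_smul, smul_eq_mul]

/-- Twisted vacuum states depend only on the values of the twist on the faces. -/
theorem twistState_congr {ω : Functional} (hω : IsVacuum ω) {ρ ρ' : QuasiLocal →⋆ₐ[ℂ] QuasiLocal}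
    {k : Pauli} {φ φ' : Config →+ Fin 2} (h : IsTwist ρ k φ) (h' : IsTwist ρ' k φ')
    (hφ : ∀ f : Face, φ f.bd = φ' f.bd) : twistState ω ρ = twistState ω ρ' := by
  refine functional_ext fun a b => ?_
  rw [h.apply, h'.apply]
  by_cases hab : a ∈ faceSpan ∧ b ∈ faceSpan
  · rw [hom_eq_of_bd hφ (sel_mem k hab.1 hab.2)]
  · rw [vacuum_zero hω hab, mul_zero, mul_zero]

/-- Twists by charges at two faces of the same color give equivalent representations. -/
theorem equivalent_twist {ω : Functional} (hω : IsVacuum ω)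
    {ρ ρ' : QuasiLocal →⋆ₐ[ℂ] QuasiLocal} {k : Pauli} {φ φ' : Config →+ Fin 2}
    (h : IsTwist ρ k φ) (h' : IsTwist ρ' k φ') {f f' : Face}
    (hφ : ∀ g : Face, φ g.bd = delta f g) (hφ' : ∀ g : Face, φ' g.bd = delta f' g)
    (hc : f.color = f'.color) : Equivalent (gns (twistState ω ρ)) (gns (twistState ω ρ')) := by
  obtain ⟨l, hl⟩ := joined_of_color_eq hc
  -- Conjugation by the finite string `l` moves the charge from `f'` to `f`, so the composite has
  -- the face values of `φ`.
  have ht : IsTwist (ρ'.comp (stringConj k l)) k (φ' + pair (chain l)) := by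
    intro a b
    rw [StarAlgHom.comp_apply, stringConj_isTwist, map_smul, h', smul_smul, ← sgn_add,
      AddMonoidHom.add_apply, add_comm]
  have he : twistState ω ρ = twistState ω (ρ'.comp (stringConj k l)) := by
    refine twistState_congr hω h ht fun g => ?_
    rw [AddMonoidHom.add_apply, hφ, hφ', hl]
    linear_combination - fin_two_add_self (delta f' g)
  rw [he]
  refine equivalent_of_conj (stringOp_unitary k l) fun a => ?_
  rw [twistState_apply, twistState_apply, StarAlgHom.comp_apply, stringConj_apply]

/-! ### Half-infinite strings as limits of finite ones. -/

/-- Homomorphisms whose values on each vertex stabilize have a limit. -/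
theorem exists_limit_hom (φ : ℕ → Config →+ Fin 2)
    (h : ∀ v, ∃ x, ∀ᶠ n in atTop, φ n (Finsupp.single v 1) = x) :
    ∃ ψ : Config →+ Fin 2, ∀ c, ∀ᶠ n in atTop, φ n c = ψ c := by
  have h' : ∀ c, ∃ x, ∀ᶠ n in atTop, φ n c = x := by
    intro c
    induction c using Finsupp.induction_linear with
    | zero => exact ⟨0, by simp⟩
    | add f g hf hg =>
      obtain ⟨x, hx⟩ := hf
      obtain ⟨y, hy⟩ := hg
      refine ⟨x + y, ?_⟩
      filter_upwards [hx, hy] with n h1 h2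
      rw [map_add, h1, h2]
    | single v x =>
      rcases fin_two_cases x with rfl | rfl
      · exact ⟨0, by simp⟩
      · exact h v
  choose ψ hψ using h'
  refine ⟨{ toFun := ψ, map_zero' := ?_, map_add' := fun a b => ?_ }, hψ⟩
  · obtain ⟨n, hn⟩ := (hψ 0).exists
    rw [← hn, map_zero]
  · obtain ⟨n, h1, h2, h3⟩ := ((hψ a).and ((hψ b).and (hψ (a + b)))).exists
    rw [← h1, ← h2, ← h3, map_add]

theorem exists_limit_chain (L : ℕ → List Vertex)
    (hL : ∀ v, ∃ N, ∀ n ≥ N, (L n).count v = (L N).count v) :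
    ∃ φ : Config →+ Fin 2, ∀ c, ∀ᶠ n in atTop, pair (chain (L n)) c = φ c := by
  refine exists_limit_hom (fun n => pair (chain (L n))) fun v => ?_
  obtain ⟨N, hN⟩ := hL v
  refine ⟨((L N).count v : Fin 2), ?_⟩
  filter_upwards [eventually_ge_atTop N] with n hn
  rw [pair_single, mul_one, chain_apply, hN n hn]

/-- A sequence of endomorphisms that is eventually constant on a dense set converges pointwise. -/
theorem exists_limit_starAlgHom (α : ℕ → QuasiLocal →⋆ₐ[ℂ] QuasiLocal) {s : Set QuasiLocal}
    (hs : Dense s) (h : ∀ a ∈ s, ∃ b, ∀ᶠ n in atTop, α n a = b) :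
    ∃ ρ : QuasiLocal →⋆ₐ[ℂ] QuasiLocal, ∀ a, Tendsto (fun n => α n a) atTop (𝓝 (ρ a)) := by
  have hlim : ∀ a, ∃ b, Tendsto (fun n => α n a) atTop (𝓝 b) := by
    intro a
    refine cauchySeq_tendsto_of_complete (Metric.cauchySeq_iff'.2 fun ε hε => ?_)
    obtain ⟨b, hb, hab⟩ := Metric.dense_iff.1 hs a (ε / 2) (by positivity)
    rw [Metric.mem_ball, dist_comm] at hb
    obtain ⟨d, hd⟩ := h b hab
    obtain ⟨N, hN⟩ := eventually_atTop.1 hd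
    have hc : ∀ n, dist (α n a) (α n b) < ε / 2 := fun n => by
      rw [dist_eq_norm, ← map_sub]
      exact (NonUnitalStarAlgHom.norm_apply_le (α n) _).trans_lt (by rwa [← dist_eq_norm])
    refine ⟨N, fun n hn => ?_⟩
    calc _ ≤ dist (α n a) (α n b) + dist (α n b) (α N a) := dist_triangle _ _ _
      _ < ε / 2 + ε / 2 := by
        refine add_lt_add (hc n) ?_
        rw [hN n hn, ← hN N le_rfl, dist_comm]
        exact hc N
      _ = ε := add_halves ε
  choose ρ hρ using hlim
  refine ⟨{ toFun := ρ, map_one' := ?_, map_mul' := fun a b => ?_, map_zero' := ?_,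
            map_add' := fun a b => ?_, commutes' := fun r => ?_, map_star' := fun a => ?_ }, hρ⟩
  · exact tendsto_nhds_unique (hρ 1) (by simp)
  · exact tendsto_nhds_unique (hρ _) (by simpa using (hρ a).mul (hρ b))
  · exact tendsto_nhds_unique (hρ 0) (by simp)
  · exact tendsto_nhds_unique (hρ _) (by simpa using (hρ a).add (hρ b))
  · exact tendsto_nhds_unique (hρ _) (by simp [AlgHomClass.commutes])
  · exact tendsto_nhds_unique (hρ _) (by simpa [map_star] using (hρ a).star)

/-- Every limit of finite chains is realized by a twist. -/
theorem exists_twist (k : Pauli) (L : ℕ → List Vertex) {φ : Config →+ Fin 2}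
    (hφ : ∀ c, ∀ᶠ n in atTop, pair (chain (L n)) c = φ c) :
    ∃ ρ, IsTwist ρ k φ := by
  have key : ∀ a b, ∀ᶠ n in atTop, stringConj k (L n) (X a * Z b)
      = sgn (φ (sel k a b)) • (X a * Z b) := fun a b => by
    filter_upwards [hφ (sel k a b)] with n hn
    rw [stringConj_isTwist k (L n), hn]
  obtain ⟨ρ, hρ⟩ := exists_limit_starAlgHom (fun n => stringConj k (L n)) dense_span_XZ (by
    intro A hA
    induction hA using Submodule.span_induction with
    | mem x hx => obtain ⟨⟨a, b⟩, rfl⟩ := hx; exact ⟨_, key a b⟩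
    | zero => exact ⟨0, by simp⟩
    | add x y _ _ h1 h2 =>
      obtain ⟨x', hx⟩ := h1
      obtain ⟨y', hy⟩ := h2
      refine ⟨x' + y', ?_⟩
      filter_upwards [hx, hy] with n h1 h2
      rw [map_add, h1, h2]
    | smul r x _ h =>
      obtain ⟨x', hx⟩ := h
      refine ⟨r • x', ?_⟩
      filter_upwards [hx] with n h1
      rw [map_smul, h1])
  refine ⟨ρ, fun a b => tendsto_nhds_unique (hρ _) ?_⟩
  exact tendsto_const_nhds.congr' ((key a b).mono fun n hn => hn.symm)

/-- A telescoping sum: `trunc (n + 1)` consists of `n` edges, and the intermediate faces are counted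
twice. -/
theorem pair_trunc {c : Color} (γ : HalfInfiniteString c) (n : ℕ) (h : Face) :
    pair (chain (γ.trunc (n + 1))) h.bd = delta (γ.face 0) h + delta (γ.face n) h := by
  induction n with
  | zero => simp [HalfInfiniteString.trunc, fin_two_add_self]
  | succ n ih =>
    have e : γ.trunc (n + 1 + 1) = γ.trunc (n + 1) ++ [γ.vtx (2 * n), γ.vtx (2 * n + 1)] := by
      simp only [HalfInfiniteString.trunc, Nat.add_sub_cancel]
      rw [show 2 * (n + 1) = 2 * n + 1 + 1 by ring, List.range_succ, List.range_succ]
      simp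
    rw [e, chain_append, pair_add_left, ih, pair_chain]
    have := (γ.connects n).bd_add h
    simp only [List.map_cons, List.map_nil, List.sum_cons, List.sum_nil, add_zero]
    rw [this]
    linear_combination fin_two_add_self (delta (γ.face n) h)

/-- The endomorphism of a string is the twist by a charge at its starting face. -/
theorem endo_isTwist {c : Color} (γ : HalfInfiniteString c) (k : Pauli) :
    ∃ φ : Config →+ Fin 2, IsTwist (γ.endo k) k φ ∧ ∀ h : Face, φ h.bd = delta (γ.face 0) h := by
  obtain ⟨φ, hφ⟩ := exists_limit_chain γ.trunc γ.eventually_count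
  refine ⟨φ, fun a b => ?_, fun h => ?_⟩
  · refine γ.endoFun_eq k (tendsto_const_nhds.congr' ?_)
    filter_upwards [hφ (sel k a b)] with n hn
    rw [HalfInfiniteString.conj, stringOp_conj, hn]
  -- Each occurrence of `h` uses one of its six vertices, and each of these is visited finitely
  -- often. Hence the far end of the truncated string eventually leaves `h`, and only the starting
  -- face contributes.
  · have hfin : {n | γ.face n = h}.Finite := by
      have h1 : (⋃ v ∈ h.boundary.toFinset, {n | γ.vtx n = v}).Finite :=
        Set.Finite.biUnion (Finset.finite_toSet _) fun v _ => γ.finite_visits v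
      refine (h1.preimage (f := fun n => 2 * n) fun a _ b _ hab => ?_).subset fun n hn => ?_
      · simpa using hab
      · have := (γ.connects n).mem_left
        rw [show γ.face n = h from hn] at this
        simpa using this
    obtain ⟨B, hB⟩ := hfin.bddAbove
    have h2 : ∀ᶠ n in atTop, pair (chain (γ.trunc (n + 1))) h.bd = φ h.bd :=
      (tendsto_add_atTop_nat 1).eventually (hφ h.bd)
    obtain ⟨n, hn, hn'⟩ := (h2.and (eventually_gt_atTop B)).exists
    rw [← hn, pair_trunc, delta_of_ne (f := γ.face n), add_zero]
    intro e
    have := hB (show n ∈ {n | γ.face n = h} from e.symm)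
    omega

/-! ### Charges localized in cones and the superselection criterion. -/

theorem dense_rational_points :
    DenseRange fun q : ℚ × ℚ => (!₂[(q.1 : ℝ), (q.2 : ℝ)] : EuclideanSpace ℝ (Fin 2)) := by
  have h1 : DenseRange (Prod.map ((↑) : ℚ → ℝ) ((↑) : ℚ → ℝ)) :=
    Rat.denseRange_cast.prodMap Rat.denseRange_cast
  have hs : Function.Surjective
      fun q : ℝ × ℝ => (!₂[q.1, q.2] : EuclideanSpace ℝ (Fin 2)) := fun x =>
    ⟨(x 0, x 1), by ext i; fin_cases i <;> rfl⟩
  exact hs.denseRange.comp h1 (by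
    refine (PiLp.continuous_toLp 2 _).comp (continuous_pi fun i => ?_)
    fin_cases i <;> simp <;> fun_prop)

/-- A cone contains a lattice direction: far along it, all vertices are in the cone. -/
theorem IsCone.exists_direction {Λ : Set Vertex} (h : IsCone Λ) :
    ∃ u : ℤ × ℤ, u ≠ 0 ∧ ∀ v, ∀ᶠ n : ℕ in atTop, shiftVertex (n • u) v ∈ Λ := by
  obtain ⟨p, a, θ, ha, h0, hπ, rfl⟩ := h
  set G : Set (EuclideanSpace ℝ (Fin 2)) := {x | ‖x‖ * Real.cos θ < ⟪x, a⟫_ℝ} with hG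
  have hopen : IsOpen G := isOpen_lt (by fun_prop) (by fun_prop)
  have hsmul : ∀ r : ℝ, 0 < r → ∀ x, r • x ∈ G ↔ x ∈ G := by
    intro r hr x
    simp only [hG, Set.mem_ofPred_eq, norm_smul, real_inner_smul_left, Real.norm_of_nonneg hr.le,
      mul_assoc]
    exact mul_lt_mul_iff_right₀ hr
  have haG : a ∈ G := by
    simp only [hG, Set.mem_ofPred_eq, ha, real_inner_self_eq_norm_sq]
    have : Real.cos θ < 1 := by
      rw [← Real.cos_zero]
      exact Real.cos_lt_cos_of_nonneg_of_le_pi le_rfl hπ.le h0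
    simpa using this
  obtain ⟨⟨q, r⟩, hqr⟩ := dense_rational_points.exists_mem_open hopen ⟨a, haG⟩
  -- Denominators are cleared in a rational direction of the open cone `G` with apex 0.
  set u : ℤ × ℤ := (q.num * r.den, r.num * q.den) with hu
  have hpos : position u
      = ((q.den : ℝ) * r.den) • (!₂[(q : ℝ), (r : ℝ)] : EuclideanSpace ℝ (Fin 2)) := by
    have hq : (q.den : ℝ) * q = q.num := by exact_mod_cast Rat.den_mul_eq_num q
    have hr : (r.den : ℝ) * r = r.num := by exact_mod_cast Rat.den_mul_eq_num r
    ext i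
    fin_cases i
    · simp only [position, hu]
      simp
      linear_combination - (r.den : ℝ) * hq
    · simp only [position, hu]
      simp
      linear_combination - (q.den : ℝ) * hr
  have huG : position u ∈ G := by
    rw [hpos, hsmul _ (by have := q.den_pos; have := r.den_pos; positivity)]
    exact hqr
  refine ⟨u, ?_, fun v => ?_⟩
  · intro h
    rw [h] at huG
    have : position 0 = 0 := by ext i; fin_cases i <;> simp [position]
    rw [this] at huG
    simp [hG] at huG
  · have e : ∀ n : ℕ, position (shiftVertex (n • u) v) - p
        = (position v - p) + (6 * (n : ℝ)) • position u := by
      intro n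
      ext i
      fin_cases i <;> simp [position, shiftVertex] <;> ring
    -- After division by `6 * n` the displacement from the apex tends to `position u`, an interior
    -- point of the scale-invariant set `G`.
    have hlim : Tendsto (fun n : ℕ => (6 * (n : ℝ))⁻¹ • (position v - p) + position u) atTop
        (𝓝 ((0 : ℝ) • (position v - p) + position u)) := by
      refine Tendsto.add (Tendsto.smul ?_ tendsto_const_nhds) tendsto_const_nhds
      exact tendsto_inv_atTop_zero.comp
        (tendsto_natCast_atTop_atTop.const_mul_atTop (by norm_num))
    rw [zero_smul, zero_add] at hlim
    filter_upwards [hlim.eventually (hopen.mem_nhds huG), eventually_gt_atTop 0] with n hn hn0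
    have h6 : (0 : ℝ) < 6 * n := by positivity
    replace hn : (6 * (n : ℝ))⁻¹ • (position v - p) + position u ∈ G := hn
    rw [← hsmul _ h6, smul_add, smul_smul, mul_inv_cancel₀ h6.ne', one_smul, ← e] at hn
    exact hn

theorem eventually_shiftVertex_ne {u : ℤ × ℤ} (hu : u ≠ 0) (v w : Vertex) :
    ∀ᶠ n : ℕ in atTop, shiftVertex (n • u) w ≠ v := by
  have hs : {n : ℕ | shiftVertex (n • u) w = v}.Subsingleton := by
    intro m hm n hn
    have h := hm.trans hn.symm
    simp only [shiftVertex, Prod.mk.injEq, add_right_inj,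
      nsmul_eq_mul, mul_eq_mul_left_iff, OfNat.ofNat_ne_zero, or_false] at h
    by_contra hmn
    refine hu (Prod.ext ?_ ?_)
    · simpa [hmn] using h.1
    · simpa [hmn] using h.2
  obtain ⟨B, hB⟩ := hs.finite.bddAbove
  filter_upwards [eventually_gt_atTop B] with n hn e
  exact absurd (hB (show n ∈ {n : ℕ | shiftVertex (n • u) w = v} from e)) (by omega)

theorem eventually_shift_ne {u : ℤ × ℤ} (hu : u ≠ 0) (f h : Face) :
    ∀ᶠ n : ℕ in atTop, h ≠ f.shift (n • u) := by
  filter_upwards [eventually_shiftVertex_ne hu (h.col, h.row) (f.col, f.row)] with n hn e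
  exact hn (by rw [e]; rfl)

/-- The concatenation of the translates of a list by multiples of `6 u`. -/
def translates (u : ℤ × ℤ) (l : List Vertex) (N n : ℕ) : List Vertex :=
  (List.range n).flatMap fun j => l.map (shiftVertex ((N + j) • u))

theorem translates_succ (u : ℤ × ℤ) (l : List Vertex) (N n : ℕ) : translates u l N (n + 1)
    = translates u l N n ++ l.map (shiftVertex ((N + n) • u)) := by
  simp [translates, List.range_succ]

theorem translates_count {u : ℤ × ℤ} (hu : u ≠ 0) (l : List Vertex) (N : ℕ) (v : Vertex) :
    ∃ M, ∀ n ≥ M, (translates u l N n).count v = (translates u l N M).count v := by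
  have h : ∀ᶠ n : ℕ in atTop, ∀ w ∈ l.toFinset, shiftVertex (n • u) w ≠ v :=
    (Filter.eventually_all_finset _).2 fun w _ => eventually_shiftVertex_ne hu v w
  obtain ⟨M, hM⟩ := eventually_atTop.1 h
  refine ⟨M, fun n hn => ?_⟩
  induction n, hn using Nat.le_induction with
  | base => rfl
  | succ n hn ih =>
    rw [translates_succ, List.count_append, ih, Nat.add_eq_left, List.count_eq_zero]
    intro hv
    obtain ⟨w, hw, e⟩ := List.mem_map.1 hv
    exact hM (N + n) (by omega) w (by simpa using hw) e

/-- Telescoping again: each translate of `l` starts at the face where the preceding one ends. -/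
theorem pair_translates {u : ℤ × ℤ} {l : List Vertex} {f : Face}
    (hl : ∀ h : Face, pair (chain l) h.bd = delta f h + delta (f.shift u) h) (N n : ℕ) (h : Face) :
    pair (chain (translates u l N n)) h.bd
      = delta (f.shift (N • u)) h + delta (f.shift ((N + n) • u)) h := by
  induction n with
  | zero => simp [translates, fin_two_add_self]
  | succ n ih =>
    rw [translates_succ, chain_append, pair_add_left, ih, pair_shift, hl, delta_shift, delta_shift,
      Face.shift_shift, ← add_assoc N n 1, succ_nsmul' u (N + n)]
    linear_combination fin_two_add_self (delta (f.shift ((N + n) • u)) h)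

/-- Each cone supports a charge of the color of `f` and of any type. -/
theorem exists_twist_in_cone {Λ : Set Vertex} (hΛ : IsCone Λ) (f : Face) (k : Pauli) :
    ∃ (ρ : QuasiLocal →⋆ₐ[ℂ] QuasiLocal) (φ : Config →+ Fin 2) (g : Face), IsTwist ρ k φ ∧
      g.color = f.color ∧ (∀ h : Face, φ h.bd = delta g h) ∧
      ∀ v ∉ Λ, φ (Finsupp.single v 1) = 0 := by
  obtain ⟨u, hu, hdir⟩ := hΛ.exists_direction
  -- A finite string from `f` to its translate is repeated along the direction `u`, beginning so far
  -- out that every copy lies in the cone. The other end escapes to infinity, leaving a single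
  -- charge.
  obtain ⟨l, hl⟩ := joined_of_color_eq (f.shift_color u).symm
  obtain ⟨N, hN⟩ := eventually_atTop.1
    ((Filter.eventually_all_finset l.toFinset).2 fun w _ => hdir w)
  obtain ⟨φ, hφ⟩ := exists_limit_chain (translates u l N) (translates_count hu l N)
  obtain ⟨ρ, hρ⟩ := exists_twist k _ hφ
  refine ⟨ρ, φ, f.shift (N • u), hρ, f.shift_color _, fun h => ?_, fun v hv => ?_⟩
  · have h1 : ∀ᶠ n : ℕ in atTop, h ≠ f.shift ((N + n) • u) := by
      have := (tendsto_add_atTop_nat N).eventually (eventually_shift_ne hu f h)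
      simpa only [add_comm] using this
    obtain ⟨n, hn, hn'⟩ := (h1.and (hφ h.bd)).exists
    rw [← hn', pair_translates hl, delta_of_ne hn, add_zero]
  · obtain ⟨n, hn⟩ := (hφ (Finsupp.single v 1)).exists
    rw [← hn, pair_single, mul_one, chain_apply, List.count_eq_zero.2, Nat.cast_zero]
    intro hmem
    obtain ⟨j, -, hj⟩ := List.mem_flatMap.1 hmem
    obtain ⟨w, hw, rfl⟩ := List.mem_map.1 hj
    exact hv (hN _ (by omega) w (by simpa using hw))

/-- Each Pauli product is an eigenvector of `ρ` with eigenvalue ±1, hence lies in the range. -/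
theorem IsTwist.denseRange {ρ : QuasiLocal →⋆ₐ[ℂ] QuasiLocal} {k : Pauli} {φ : Config →+ Fin 2}
    (h : IsTwist ρ k φ) : DenseRange ρ := by
  refine dense_span_XZ.mono ?_
  have : Submodule.span ℂ (Set.range fun p : Config × Config => X p.1 * Z p.2)
      ≤ LinearMap.range (ρ : QuasiLocal →ₗ[ℂ] QuasiLocal) := by
    refine Submodule.span_le.2 ?_
    rintro _ ⟨⟨a, b⟩, rfl⟩
    refine ⟨sgn (φ (sel k a b)) • (X a * Z b), ?_⟩
    change ρ _ = _
    rw [map_smul, h, smul_smul, sgn_mul_self, one_smul]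
  intro A hA
  obtain ⟨B, hB⟩ := this hA
  exact ⟨B, hB⟩

theorem IsTwist.eq_on_local {ρ : QuasiLocal →⋆ₐ[ℂ] QuasiLocal} {k : Pauli} {φ : Config →+ Fin 2}
    (h : IsTwist ρ k φ) {Λ : Set Vertex} (hφ : ∀ v ∈ Λ, φ (Finsupp.single v 1) = 0)
    {A : QuasiLocal} (hA : A ∈ localAlgebra Λ) : ρ A = A := by
  have hX : ∀ v ∈ Λ, ρ (X (Finsupp.single v 1)) = X (Finsupp.single v 1) := fun v hv => by
    have h1 := h (Finsupp.single v 1) 0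
    have h2 : φ (sel k (Finsupp.single v 1) 0) = 0 := by cases k <;> simp [sel, hφ v hv]
    simpa [h2] using h1
  have hZ : ∀ v ∈ Λ, ρ (Z (Finsupp.single v 1)) = Z (Finsupp.single v 1) := fun v hv => by
    have h1 := h 0 (Finsupp.single v 1)
    have h2 : φ (sel k 0 (Finsupp.single v 1)) = 0 := by cases k <;> simp [sel, hφ v hv]
    simpa [h2] using h1
  have hle : localAlgebra Λ ≤ StarAlgHom.equalizer ρ (StarAlgHom.id ℂ QuasiLocal) := by
    refine StarSubalgebra.topologicalClosure_minimal ?_ ?_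
    · refine StarAlgHom.adjoin_le_equalizer _ _ ?_
      rintro _ ⟨v, hv, M, rfl⟩
      rw [site_eq]
      simp [hX v hv, hZ v hv]
    · have hc : Continuous ρ := AddMonoidHomClass.continuous_of_bound ρ 1 fun a => by
        rw [one_mul]; exact NonUnitalStarAlgHom.norm_apply_le ρ a
      exact isClosed_eq hc continuous_id
  exact hle hA

theorem superselection {ω : Functional} (hω : IsVacuum ω) {c : Color} (k : Pauli)
    (γ : HalfInfiniteString c) : SatisfiesSuperselection ω (gns (stringState ω γ k)) := by
  intro Λ hΛ
  obtain ⟨φ, hφ, hφ'⟩ := endo_isTwist γ k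
  obtain ⟨ρ, ψ, g, hρ, hg, hψ, hsupp⟩ := exists_twist_in_cone hΛ (γ.face 0) k
  have h1 : Equivalent (gns (stringState ω γ k)) (gns (twistState ω ρ)) :=
    equivalent_twist hω hφ hρ hφ' hψ hg.symm
  -- The vacuum vector stays cyclic for `(gns ω).comp ρ` because `ρ` has dense range, and there it
  -- induces the twisted state.
  have h2 : Equivalent (gns (twistState ω ρ)) ((gns ω).comp ρ) := by
    refine equivalent_gns_of_cyclic (ξ := cyclicVector ω) ?_ fun a => ?_
    · refine (dense_cyclicVector ω).comp hρ.denseRange ?_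
      have := continuous_rep (gns ω)
      fun_prop
    · rw [StarAlgHom.comp_apply, inner_cyclicVector, twistState_apply]
  obtain ⟨U, hU⟩ := h1.trans h2
  refine ⟨U, fun a ha x => ?_⟩
  rw [hU, StarAlgHom.comp_apply, hρ.eq_on_local (fun v hv => hsupp v hv) ha]

/-! ### Loops far out distinguish the types. -/

theorem commute_X_X (a b : Config) : Commute (X a) (X b) := by
  rw [Commute, SemiconjBy, ← X_add, ← X_add, add_comm]

theorem commute_Z_Z (a b : Config) : Commute (Z a) (Z b) := by
  rw [Commute, SemiconjBy, ← Z_add, ← Z_add, add_comm]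

theorem commute_Z_X {a b : Config} (h : pair a b = 0) : Commute (Z b) (X a) := by
  rw [Commute, SemiconjBy, Z_mul_X, h, sgn_zero, one_smul]

theorem commute_site {v : Vertex} {a b : Config} (ha : a v = 0) (hb : b v = 0)
    (M : Matrix (Fin 2) (Fin 2) ℂ) : Commute (X a * Z b) (site v M) := by
  have hX : Commute (X a * Z b) (X (Finsupp.single v 1)) :=
    (commute_X_X _ _).mul_left (commute_Z_X (by rw [pair_comm]; simp [hb]))
  have hZ : Commute (X a * Z b) (Z (Finsupp.single v 1)) :=
    (commute_Z_X (by simp [ha])).symm.mul_left (commute_Z_Z _ _)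
  rw [site_eq]
  exact ((((Commute.one_right _).smul_right _).add_right (hX.smul_right _)).add_right
    (hZ.smul_right _)).add_right ((hX.mul_right hZ).smul_right _)

/-- A strictly local observable commutes with the Pauli operators outside a finite set. -/
theorem exists_commute {B : QuasiLocal} (hB : B ∈ strictlyLocalAlgebra Set.univ) :
    ∃ F : Finset Vertex, ∀ a b : Config, (∀ v ∈ F, a v = 0) → (∀ v ∈ F, b v = 0) →
      Commute (X a * Z b) B ∧ Commute (X a * Z b) (star B) := by
  classical
  induction hB using StarAlgebra.adjoin_induction with
  | mem A hA =>
    obtain ⟨v, -, M, rfl⟩ := hA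
    refine ⟨{v}, fun a b ha hb => ?_⟩
    rw [← map_star]
    exact ⟨commute_site (ha v (by simp)) (hb v (by simp)) M,
      commute_site (ha v (by simp)) (hb v (by simp)) _⟩
  | algebraMap r =>
    refine ⟨∅, fun a b _ _ => ⟨Algebra.commute_algebraMap_right r _, ?_⟩⟩
    rw [← algebraMap_star_comm]
    exact Algebra.commute_algebraMap_right _ _
  | add A B _ _ hA hB =>
    obtain ⟨F, hF⟩ := hA
    obtain ⟨G, hG⟩ := hB
    refine ⟨F ∪ G, fun a b ha hb => ?_⟩
    have h1 := hF a b (fun v hv => ha v (Finset.mem_union_left _ hv))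
      fun v hv => hb v (Finset.mem_union_left _ hv)
    have h2 := hG a b (fun v hv => ha v (Finset.mem_union_right _ hv))
      fun v hv => hb v (Finset.mem_union_right _ hv)
    rw [star_add]
    exact ⟨h1.1.add_right h2.1, h1.2.add_right h2.2⟩
  | mul A B _ _ hA hB =>
    obtain ⟨F, hF⟩ := hA
    obtain ⟨G, hG⟩ := hB
    refine ⟨F ∪ G, fun a b ha hb => ?_⟩
    have h1 := hF a b (fun v hv => ha v (Finset.mem_union_left _ hv))
      fun v hv => hb v (Finset.mem_union_left _ hv)
    have h2 := hG a b (fun v hv => ha v (Finset.mem_union_right _ hv))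
      fun v hv => hb v (Finset.mem_union_right _ hv)
    rw [star_mul]
    exact ⟨h1.1.mul_right h2.1, h2.2.mul_right h1.2⟩
  | star A _ hA =>
    obtain ⟨F, hF⟩ := hA
    refine ⟨F, fun a b ha hb => ?_⟩
    rw [star_star]
    exact (hF a b ha hb).symm

theorem rep_eigen {H : Type*} [NormedAddCommGroup H] [InnerProductSpace ℂ H] [CompleteSpace H]
    {π : Rep H} {ξ : H} (hξ : ‖ξ‖ = 1) {S : QuasiLocal} (hS : S ∈ unitary QuasiLocal) {x : Fin 2}
    (h : ⟪ξ, π S ξ⟫_ℂ = sgn x) : π S ξ = sgn x • ξ := by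
  rcases fin_two_cases x with rfl | rfl
  · simpa using rep_fix hξ hS h
  · have h1 := rep_fix (π := π) hξ (S := -S) (-(⟨S, hS⟩ : unitary QuasiLocal)).2 (by simp [h])
    rw [map_neg, neg_apply, neg_eq_iff_eq_neg] at h1
    simp [h1]

/-- Equivalent states have the same charge at infinity. -/
theorem charge_eq {ω₁ ω₂ : Functional} (h₁ : ω₁ 1 = 1) (h₂ : ω₂ 1 = 1)
    (hE : Equivalent (gns ω₁) (gns ω₂)) {x y : Fin 2}
    (h : ∀ F : Finset Vertex, ∃ a b : Config, (∀ v ∈ F, a v = 0) ∧ (∀ v ∈ F, b v = 0) ∧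
      ω₁ (X a * Z b) = sgn x ∧ ω₂ (X a * Z b) = sgn y) : x = y := by
  by_contra hxy
  obtain ⟨U, hU⟩ := hE
  set ξ := U (cyclicVector ω₁) with hξ
  have hξn : ‖ξ‖ = 1 := by rw [hξ, U.norm_map, norm_cyclicVector h₁]
  have hd : Dense ((fun a => gns ω₂ a (cyclicVector ω₂)) ''
      (strictlyLocalAlgebra Set.univ : Set QuasiLocal)) :=
    (dense_cyclicVector ω₂).dense_image
      (by have := continuous_rep (gns ω₂); fun_prop) dense_strictlyLocal
  -- A local vector `η` is chosen at distance less than 1 from the unit vector `ξ`. A loop operator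
  -- `S` commuting with `B` has `ξ` and `η` as eigenvectors for opposite signs. They are then
  -- orthogonal, so their distance is at least 1, a contradiction.
  obtain ⟨_, hB1, B, hB, rfl⟩ := Metric.dense_iff.1 hd ξ 1 one_pos
  set η := gns ω₂ B (cyclicVector ω₂) with hη
  obtain ⟨F, hF⟩ := exists_commute hB
  obtain ⟨a, b, ha, hb, h1, h2⟩ := h F
  set S := X a * Z b with hS
  have hSu : S ∈ unitary QuasiLocal := mul_mem (X_unitary a) (Z_unitary b)
  have e1 : gns ω₂ S ξ = sgn x • ξ := by
    rw [hξ, ← hU, rep_eigen (norm_cyclicVector h₁) hSu (by rw [inner_cyclicVector, h1]), map_smul]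
  have e2 : gns ω₂ S η = sgn y • η := by
    rw [hη, ← mul_apply_eq_comp, ← map_mul, (hF a b ha hb).1.eq, map_mul, mul_apply_eq_comp,
      rep_eigen (norm_cyclicVector h₂) hSu (by rw [inner_cyclicVector, h2]), map_smul]
  have hsgn : (starRingEnd ℂ) (sgn x) * sgn y = -1 := by
    rcases fin_two_cases x with rfl | rfl <;> rcases fin_two_cases y with rfl | rfl <;>
      simp at hxy ⊢
  have hin : ⟪ξ, η⟫_ℂ = 0 := by
    have h3 : ⟪gns ω₂ S ξ, gns ω₂ S η⟫_ℂ = ⟪ξ, η⟫_ℂ := by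
      rw [inner_rep, hSu.1, map_one]
      rfl
    rw [e1, e2, inner_smul_left, inner_smul_right, ← mul_assoc, hsgn] at h3
    rw [neg_one_mul] at h3
    exact CharZero.neg_eq_self_iff.1 h3
  have h4 : ‖ξ - η‖ ^ 2 = 1 + ‖η‖ ^ 2 := by
    rw [@norm_sub_sq ℂ, hin, hξn]
    simp
  rw [Metric.mem_ball, dist_comm, dist_eq_norm] at hB1
  nlinarith [norm_nonneg (ξ - η), norm_nonneg η]

open scoped Classical in
/-- The parity of the number of colors among `c₁` and `c₂` that equal `c`. -/
def colorParity (c c₁ c₂ : Color) : Fin 2 :=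
  (if c = c₁ then 1 else 0) + (if c = c₂ then 1 else 0)

/-- In a covering of `F`, the faces of color `c₁` and those of color `c₂` each cover `F` once, so
the sum of their boundaries cancels there. Since the covering includes `f` and `f'`, each
homomorphism counts its own face once for each of the two colors that it matches. -/
theorem exists_loop {φ φ' : Config →+ Fin 2} {f f' : Face}
    (hφ : ∀ h : Face, φ h.bd = delta f h) (hφ' : ∀ h : Face, φ' h.bd = delta f' h)
    (c₁ c₂ : Color) (F : Finset Vertex) :
    ∃ a ∈ faceSpan, (∀ v ∈ F, a v = 0) ∧ φ a = colorParity f.color c₁ c₂ ∧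
      φ' a = colorParity f'.color c₁ c₂ := by
  obtain ⟨D, hf, hf', hD⟩ := exists_covering F f f'
  refine ⟨colorSum D c₁ + colorSum D c₂, add_mem (colorSum_mem _ _) (colorSum_mem _ _),
    fun v hv => ?_, ?_, ?_⟩
  · rw [Finsupp.add_apply, hD v hv, hD v hv, fin_two_add_self]
  · rw [map_add, hom_colorSum hφ hf, hom_colorSum hφ hf, colorParity]
  · rw [map_add, hom_colorSum hφ' hf', hom_colorSum hφ' hf', colorParity]

/-- The string types detected by loops of type `σˣ`. -/
def detectX : Pauli → Fin 2
  | .x => 0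
  | .y => 1
  | .z => 1

/-- The string types detected by loops of type `σᶻ`. -/
def detectZ : Pauli → Fin 2
  | .x => 1
  | .y => 1
  | .z => 0

/-- The parities for the pairs red-green and red-blue are `(1, 1)`, `(1, 0)`, `(0, 1)` for red,
green, blue: distinct and nonzero. Since `(detectX, detectZ)` is also nonzero and distinct for the
three Pauli types, the products recover both data. -/
theorem type_eq_of_parity {c c' : Color} {k k' : Pauli}
    (hX : ∀ c₁ c₂, detectX k * colorParity c c₁ c₂ = detectX k' * colorParity c' c₁ c₂)
    (hZ : ∀ c₁ c₂, detectZ k * colorParity c c₁ c₂ = detectZ k' * colorParity c' c₁ c₂) :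
    (c, k) = (c', k') := by
  have x1 := hX .r .g
  have x2 := hX .r .b
  have z1 := hZ .r .g
  have z2 := hZ .r .b
  cases k <;> cases k' <;> cases c <;> cases c' <;>
    simp [detectX, detectZ, colorParity] at x1 x2 z1 z2 ⊢

theorem twistState_one {ω : Functional} (hω : IsVacuum ω) (ρ : QuasiLocal →⋆ₐ[ℂ] QuasiLocal) :
    twistState ω ρ 1 = 1 := by
  rw [twistState_apply, map_one, hω.1]

theorem type_eq_of_equivalent {ω : Functional} (hω : IsVacuum ω)
    {ρ ρ' : QuasiLocal →⋆ₐ[ℂ] QuasiLocal} {k k' : Pauli} {φ φ' : Config →+ Fin 2}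
    (h : IsTwist ρ k φ) (h' : IsTwist ρ' k' φ') {f f' : Face}
    (hφ : ∀ g : Face, φ g.bd = delta f g) (hφ' : ∀ g : Face, φ' g.bd = delta f' g)
    (hE : Equivalent (gns (twistState ω ρ)) (gns (twistState ω ρ'))) :
    (f.color, k) = (f'.color, k') := by
  have hselX : ∀ (ψ : Config →+ Fin 2) k a, ψ (sel k a 0) = detectX k * ψ a := by
    intro ψ k a
    cases k <;> simp [sel, detectX]
  have hselZ : ∀ (ψ : Config →+ Fin 2) k a, ψ (sel k 0 a) = detectZ k * ψ a := by
    intro ψ k a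
    cases k <;> simp [sel, detectZ]
  refine type_eq_of_parity (fun c₁ c₂ => ?_) fun c₁ c₂ => ?_
  · refine charge_eq (twistState_one hω ρ) (twistState_one hω ρ') hE fun F => ?_
    obtain ⟨a, ha, hF, e, e'⟩ := exists_loop hφ hφ' c₁ c₂ F
    refine ⟨a, 0, hF, fun _ _ => rfl, ?_, ?_⟩
    · rw [h.apply, vacuum_one hω ha (zero_mem _), hselX, e, mul_one]
    · rw [h'.apply, vacuum_one hω ha (zero_mem _), hselX, e', mul_one]
  · refine charge_eq (twistState_one hω ρ) (twistState_one hω ρ') hE fun F => ?_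
    obtain ⟨a, ha, hF, e, e'⟩ := exists_loop hφ hφ' c₁ c₂ F
    refine ⟨0, a, fun _ _ => rfl, hF, ?_, ?_⟩
    · rw [h.apply, vacuum_one hω (zero_mem _) ha, hselZ, e, mul_one]
    · rw [h'.apply, vacuum_one hω (zero_mem _) ha, hselZ, e', mul_one]

/-! ### Existence of the vacuum. -/

/-- The product of the operators `1 + K_f` over a list of faces. -/
def faceProd (l : List Face) : QuasiLocal := (l.map fun f => 1 + X f.bd).prod

theorem faceProd_cons (f : Face) (l : List Face) :
    faceProd (f :: l) = (1 + X f.bd) * faceProd l := by simp [faceProd]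

/-- The factor `1 + X f.bd` absorbs `X f.bd`, which commutes with the other factors. -/
theorem X_mul_faceProd {f : Face} {l : List Face} (h : f ∈ l) :
    X f.bd * faceProd l = faceProd l := by
  induction l with
  | nil => simp at h
  | cons g l ih =>
    rw [faceProd_cons, ← mul_assoc]
    rcases List.mem_cons.1 h with rfl | h
    · rw [mul_add, X_mul_self, mul_one, add_comm]
    · rw [((Commute.one_right (X f.bd)).add_right (commute_X_X f.bd g.bd)).eq, mul_assoc, ih h]

theorem commute_Z_faceProd (f : Face) (l : List Face) : Commute (Z f.bd) (faceProd l) := by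
  induction l with
  | nil => simp [faceProd]
  | cons g l ih =>
    rw [faceProd_cons]
    exact ((Commute.one_right _).add_right (commute_Z_X (pair_bd_bd g f))).mul_right ih

/-- The reference vector, in which all qubits are in state `0`. -/
def zeroVector : RefSpace := lp.single 2 (0 : Config) (1 : ℂ)

theorem Z_zeroVector (a : Config) : toOp (Z a) zeroVector = zeroVector := by
  ext s
  rw [Z_apply]
  by_cases h : s = 0
  · simp [h]
  · simp [zeroVector, lp.single_apply, h]

/-- This keeps the vector from vanishing: the `K_f` permute the basis configurations, so all
coefficients stay nonnegative and nothing cancels at the configuration 0. -/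
theorem faceProd_zeroVector (l : List Face) :
    (∀ s, 0 ≤ toOp (faceProd l) zeroVector s) ∧ 1 ≤ toOp (faceProd l) zeroVector 0 := by
  induction l with
  | nil =>
    refine ⟨fun s => ?_, ?_⟩
    · by_cases h : s = 0
      · simp [faceProd, zeroVector, h]
      · simp [faceProd, zeroVector, lp.single_apply, h]
    · simp [faceProd, zeroVector]
  | cons f l ih =>
    have e : ∀ s, toOp (faceProd (f :: l)) zeroVector s
        = toOp (faceProd l) zeroVector s + toOp (faceProd l) zeroVector (s + f.bd) := by
      intro s
      rw [faceProd_cons, add_mul, one_mul, map_add, map_mul]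
      change toOp (faceProd l) zeroVector s + toOp (X f.bd) (toOp (faceProd l) zeroVector) s = _
      rw [X_apply]
    refine ⟨fun s => ?_, ?_⟩
    · rw [e]
      exact add_nonneg (ih.1 _) (ih.1 _)
    · rw [e]
      exact le_add_of_le_of_nonneg ih.2 (ih.1 _)

/-- Unit vectors stabilized by all `J_f` and by finitely many `K_f`. -/
theorem exists_stabilized_vector (l : List Face) : ∃ ψ : RefSpace, ‖ψ‖ = 1 ∧
    (∀ f : Face, toOp (Z f.bd) ψ = ψ) ∧ ∀ f ∈ l, toOp (X f.bd) ψ = ψ := by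
  set ψ := toOp (faceProd l) zeroVector with hψ
  have h0 : ψ ≠ 0 := by
    intro h
    have := (faceProd_zeroVector l).2
    rw [← hψ, h] at this
    simp at this
    exact absurd this (by norm_num)
  refine ⟨((‖ψ‖⁻¹ : ℝ) : ℂ) • ψ, ?_, fun f => ?_, fun f hf => ?_⟩
  · rw [norm_smul]
    simp [h0]
  · rw [map_smul, hψ, ← mul_apply_eq_comp, ← map_mul, (commute_Z_faceProd f l).eq, map_mul,
      mul_apply_eq_comp, Z_zeroVector]
  · rw [map_smul, hψ, ← mul_apply_eq_comp, ← map_mul, X_mul_faceProd hf]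

/-- Along an ultrafilter finer than `atTop` on the finite sets of faces, the bounded expectation
values all converge, and the limit inherits linearity and positivity. Each `K_f` fixes the vectors
of all sets containing `f`, hence has limit value 1; each `J_f` fixes all of the vectors. -/
theorem exists_vacuum : ∃ ω : Functional, IsVacuum ω := by
  classical
  choose ψ hn hZ hX using fun D : Finset Face => exists_stabilized_vector D.toList
  let 𝒰 : Ultrafilter (Finset Face) := Ultrafilter.of atTop
  have hlim : ∀ A, ∃ z : ℂ, Tendsto (fun D => ⟪ψ D, toOp A (ψ D)⟫_ℂ) 𝒰 (𝓝 z) := by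
    intro A
    have hb : ∀ D, ⟪ψ D, toOp A (ψ D)⟫_ℂ ∈ Metric.closedBall (0 : ℂ) ‖toOp A‖ := fun D => by
      rw [mem_closedBall_zero_iff]
      calc _ ≤ ‖ψ D‖ * ‖toOp A (ψ D)‖ := norm_inner_le_norm _ _
        _ ≤ ‖ψ D‖ * (‖toOp A‖ * ‖ψ D‖) := by gcongr; exact (toOp A).le_opNorm _
        _ = ‖toOp A‖ := by rw [hn]; ring
    obtain ⟨z, -, hz⟩ := (isCompact_closedBall (0 : ℂ) ‖toOp A‖).ultrafilter_le_nhds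
      (𝒰.map fun D => ⟪ψ D, toOp A (ψ D)⟫_ℂ)
      (by rw [Ultrafilter.coe_map, Filter.le_principal_iff]; exact Filter.mem_map.2
            (Filter.univ_mem' hb))
    exact ⟨z, hz⟩
  choose ω hω using hlim
  let ωl : QuasiLocal →ₗ[ℂ] ℂ :=
    { toFun := ω
      map_add' := fun A B => tendsto_nhds_unique (hω _) (by
        simpa [inner_add_right] using (hω A).add (hω B))
      map_smul' := fun r A => tendsto_nhds_unique (hω _) (by
        simpa [inner_smul_right] using (hω A).const_mul r) }
  have hev : ∀ {A : QuasiLocal}, (∀ᶠ D in (𝒰 : Filter (Finset Face)), toOp A (ψ D) = ψ D) →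
      ω A = 1 := fun {A} hA => by
    refine tendsto_nhds_unique (hω A) (tendsto_const_nhds.congr' ?_)
    filter_upwards [hA] with D hD
    rw [hD, inner_self_eq_norm_sq_to_K, hn]
    simp
  refine ⟨PositiveLinearMap.mk₀ ωl fun A hA => ?_, ?_, fun f => ⟨?_, ?_⟩⟩
  · obtain ⟨B, rfl⟩ := CStarAlgebra.nonneg_iff_eq_star_mul_self.1 hA
    refine ge_of_tendsto' (hω _) fun D => ?_
    rw [map_mul, map_star, mul_apply_eq_comp, ContinuousLinearMap.star_eq_adjoint,
      ContinuousLinearMap.adjoint_inner_right, inner_self_eq_norm_sq_to_K]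
    rw [← RCLike.ofReal_pow]
    exact RCLike.ofReal_nonneg.2 (sq_nonneg _)
  · exact hev (Eventually.of_forall fun D => by simp)
  · refine hev (Ultrafilter.of_le atTop ?_)
    filter_upwards [eventually_ge_atTop ({f} : Finset Face)] with D hD
    rw [Face.K_eq]
    exact hX D f (by simpa using hD)
  · refine hev (Eventually.of_forall fun D => ?_)
    rw [Face.J_eq]
    exact hZ D f

end
end ColorCode

theorem mainTheorem4 :
    -- the ground state exists and is unique
    (∃! ω₀ : ColorCode.Functional, ColorCode.IsVacuum ω₀) ∧
    ∀ ω₀ : ColorCode.Functional, ColorCode.IsVacuum ω₀ →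
      -- each face is the start of a string, and the string state depends on that face only
      (∀ f : ColorCode.Face, ∃ γ : ColorCode.HalfInfiniteString f.color, γ.face 0 = f) ∧
      (∀ (c : ColorCode.Color) (k : ColorCode.Pauli) (γ γ' : ColorCode.HalfInfiniteString c),
        γ.face 0 = γ'.face 0 →
          ColorCode.stringState ω₀ γ k = ColorCode.stringState ω₀ γ' k) ∧
      -- the superselection criterion
      (∀ (c : ColorCode.Color) (k : ColorCode.Pauli) (γ : ColorCode.HalfInfiniteString c),
        ColorCode.SatisfiesSuperselection ω₀ (ColorCode.gns (ColorCode.stringState ω₀ γ k))) ∧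
      -- independence of the starting face
      (∀ (c : ColorCode.Color) (k : ColorCode.Pauli) (γ γ' : ColorCode.HalfInfiniteString c),
        ColorCode.Equivalent (ColorCode.gns (ColorCode.stringState ω₀ γ k))
          (ColorCode.gns (ColorCode.stringState ω₀ γ' k))) ∧
      -- classification by the type
      (∀ (c c' : ColorCode.Color) (k k' : ColorCode.Pauli)
        (γ : ColorCode.HalfInfiniteString c) (γ' : ColorCode.HalfInfiniteString c'),
        ColorCode.Equivalent (ColorCode.gns (ColorCode.stringState ω₀ γ k))
          (ColorCode.gns (ColorCode.stringState ω₀ γ' k')) ↔ (c, k) = (c', k')) := by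
  obtain ⟨ω, hω⟩ := ColorCode.exists_vacuum
  refine ⟨⟨ω, hω, fun ω' h' => ColorCode.vacuum_unique h' hω⟩, fun ω₀ h₀ => ?_⟩
  have equiv : ∀ (c : ColorCode.Color) (k : ColorCode.Pauli) (γ γ' : ColorCode.HalfInfiniteString c),
      ColorCode.Equivalent (ColorCode.gns (ColorCode.stringState ω₀ γ k))
        (ColorCode.gns (ColorCode.stringState ω₀ γ' k)) := by
    intro c k γ γ'
    obtain ⟨φ, h1, h2⟩ := ColorCode.endo_isTwist γ k
    obtain ⟨φ', h1', h2'⟩ := ColorCode.endo_isTwist γ' k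
    exact ColorCode.equivalent_twist h₀ h1 h1' h2 h2' ((γ.color_face 0).trans (γ'.color_face 0).symm)
  refine ⟨ColorCode.exists_string, fun c k γ γ' h => ?_,
    fun c k γ => ColorCode.superselection h₀ k γ, equiv, fun c c' k k' γ γ' => ⟨fun h => ?_, ?_⟩⟩
  · obtain ⟨φ, h1, h2⟩ := ColorCode.endo_isTwist γ k
    obtain ⟨φ', h1', h2'⟩ := ColorCode.endo_isTwist γ' k
    exact ColorCode.twistState_congr h₀ h1 h1' fun f => by rw [h2, h2', h]
  · obtain ⟨φ, h1, h2⟩ := ColorCode.endo_isTwist γ k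
    obtain ⟨φ', h1', h2'⟩ := ColorCode.endo_isTwist γ' k'
    have := ColorCode.type_eq_of_equivalent h₀ h1 h1' h2 h2' h
    rwa [γ.color_face 0, γ'.color_face 0] at this
  · intro h
    obtain ⟨rfl, rfl⟩ := Prod.mk.inj h
    exact equiv c k γ γ'
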